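/- **Proposition 3.1.** *Syntax.* Formulas of modal dependence logic $\mathrm{MDL}$ over a set $AP$ of atomic propositions are built by $$\varphi ::= \top \mid \bot \mid q \mid \neg q \mid \varphi\vee\varphi \mid \varphi\ovee\varphi \mid \varphi\wedge\varphi \mid \mathrm{AX}\,\varphi \mid \mathrm{EX}\,\varphi \mid \mathrm{dep}(p_1,\dots,p_n;q) \mid \neg\,\mathrm{dep}(p_1,\dots,p_n;q)$$ with $n\ge 0$ and $p_1,\dots,p_n,q\in AP$; here $\ovee$ denotes classical disjunction, and the arity of $\mathrm{dep}(p_1,\dots,p_n;q)$ is $n$. For a set $M\subseteq\{\mathrm{AX},\mathrm{EX},\wedge,\vee,\ovee,\neg,\top,\bot,\mathrm{dep}\}$ let $\mathrm{MDL}[M]$ be the set of formulas built from atomic propositions using only operators from $M$, and for $k\ge 0$ let $\mathrm{MDL}_k[M]$ be the set of formulas in $\mathrm{MDL}[M]$ all of whose dependence atoms have arity at most $k$. *Semantics.* A Kripke structure is a tuple $W=(S,R,\pi)$ with a non-empty set $S$ of worlds, $R\subseteq S\times S$ and $\pi:S\to\mathcal P(AP)$. For a team $T\subseteq S$ define: $W,T\models\top$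 always; $W,T\models\bot$ iff $T=\emptyset$; $W,T\models p$ (resp. $\neg p$) iff $p\in\pi(s)$ (resp. $p\notin\pi(s)$) for all $s\in T$; $W,T\models\mathrm{dep}(p_1,\dots,p_n;q)$ iff any $s_1,s_2\in T$ with $\pi(s_1)\cap\{p_1,\dots,p_n\}=\pi(s_2)\cap\{p_1,\dots,p_n\}$ satisfy $\pi(s_1)\cap\{q\}=\pi(s_2)\cap\{q\}$; $W,T\models\neg\,\mathrm{dep}(p_1,\dots,p_n;q)$ iff $T=\emptyset$; $W,T\models\varphi\wedge\psi$ iff $W,T\models\varphi$ and $W,T\models\psi$; $W,T\models\varphi\ovee\psi$ iff $W,T\models\varphi$ or $W,T\models\psi$; $W,T\models\varphi\vee\psi$ iff there are $T_1,T_2$ with $T=T_1\cup T_2$, $W,T_1\models\varphi$ and $W,T_2\models\psi$; $W,T\models\mathrm{AX}\,\varphi$ iff $W,\{s'\mid \exists s\in T:(s,s')\in R\}\models\varphi$; $W,T\models\mathrm{EX}\,\varphi$ iff there is $T'\subseteq S$ with $W,T'\models\varphi$ such that every $s\in T$ has some $s'\in T'$ with $(s,s')\in R$. *Problem.* An instance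 consists of a Kripke structure $W=(S,R,\pi)$ with $S$ and $AP$ finite, a team $T\subseteq S$ and a formula $\varphi$ over $AP$. It is encoded as a word $\langle W,T,\varphi\rangle$ over a fixed finite alphabet, which lists $|S|$ and $|AP|$ in unary, the adjacency matrix of $R$, the $|S|\times|AP|$ incidence matrix of $\pi$, the characteristic vector of $T$, and $\varphi$ in Polish notation with the propositions written as unary indices below $|AP|$. Let $\mathrm{MDL\text{-}MC}[M]$ (resp. $\mathrm{MDL\text{-}MC}_k[M]$) be the language of all words $\langle W,T,\varphi\rangle$ such that $\varphi\in\mathrm{MDL}[M]$ (resp. $\varphi\in\mathrm{MDL}_k[M]$) and $W,T\models\varphi$. *Claim.* For every set $M\subseteq\{\mathrm{AX},\mathrm{EX},\wedge,\vee,\ovee,\neg,\top,\bot,\mathrm{dep}\}$ the problem $\mathrm{MDL\text{-}MC}[M]$ is in $\mathrm{NP}$, and $\mathrm{MDL\text{-}MC}_k[M]$ is in $\mathrm{NP}$ for every $k\ge 0$. -/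

import Mathlib

namespace ModalDep

/-! ### Modal dependence logic -/

/-- Formulas of modal dependence logic over the set `AP` of atomic propositions. Negation occurs
only in front of atomic propositions and dependence atoms. `dep ps q` is the dependence atom
`dep(p₁, …, pₙ; q)` with `ps = [p₁, …, pₙ]`, `n ≥ 0`, and `negDep ps q` is its negation. -/
inductive Formula (AP : Type*) where
  | top : Formula AP
  | bot : Formula AP
  | prop (q : AP) : Formula AP
  | negProp (q : AP) : Formula AP
  | or (φ ψ : Formula AP) : Formula AP
  | cor (φ ψ : Formula AP) : Formula AP
  | and (φ ψ : Formula AP) : Formula AP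
  | box (φ : Formula AP) : Formula AP
  | dia (φ : Formula AP) : Formula AP
  | dep (ps : List AP) (q : AP) : Formula AP
  | negDep (ps : List AP) (q : AP) : Formula AP

/-- The operators `AX`, `EX`, `∧`, `∨` (dependence disjunction), classical disjunction,
atomic negation, `⊤`, `⊥` and the dependence operator. -/
inductive Op where
  | box | dia | and | or | cor | neg | top | bot | dep

/-- The set of operators that occur in a formula. -/
def Formula.ops {AP : Type*} : Formula AP → Set Op
  | .top => {Op.top}
  | .bot => {Op.bot}
  | .prop _ => ∅
  | .negProp _ => {Op.neg}
  | .or φ ψ => {Op.or} ∪ (φ.ops ∪ ψ.ops)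
  | .cor φ ψ => {Op.cor} ∪ (φ.ops ∪ ψ.ops)
  | .and φ ψ => {Op.and} ∪ (φ.ops ∪ ψ.ops)
  | .box φ => {Op.box} ∪ φ.ops
  | .dia φ => {Op.dia} ∪ φ.ops
  | .dep _ _ => {Op.dep}
  | .negDep _ _ => {Op.neg, Op.dep}

/-- Every dependence atom (negated or not) that occurs in the formula has arity at most `k`;
the arity of `dep(p₁, …, pₙ; q)` is `n`. -/
def Formula.ArityLE {AP : Type*} (k : ℕ) : Formula AP → Prop
  | .top => True
  | .bot => True
  | .prop _ => True
  | .negProp _ => True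
  | .or φ ψ => φ.ArityLE k ∧ ψ.ArityLE k
  | .cor φ ψ => φ.ArityLE k ∧ ψ.ArityLE k
  | .and φ ψ => φ.ArityLE k ∧ ψ.ArityLE k
  | .box φ => φ.ArityLE k
  | .dia φ => φ.ArityLE k
  | .dep ps _ => ps.length ≤ k
  | .negDep ps _ => ps.length ≤ k

/-- The fragment `MDL[M]`. -/
def MDL (AP : Type*) (M : Set Op) : Set (Formula AP) :=
  {φ | φ.ops ⊆ M}

/-- The fragment `MDL_k[M]`. -/
def MDLk (AP : Type*) (k : ℕ) (M : Set Op) : Set (Formula AP) :=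
  {φ | φ.ops ⊆ M ∧ φ.ArityLE k}

/-- A Kripke structure over the atomic propositions `AP` with non-empty set of worlds `S`. -/
structure Kripke (AP S : Type*) where
  nonempty : Nonempty S
  /-- The accessibility relation. -/
  R : S → S → Prop
  /-- The labeling function. -/
  label : S → Set AP

/-- Team semantics: `Sat W T φ` is `W, T ⊨ φ`. -/
def Sat {AP S : Type*} (W : Kripke AP S) : Set S → Formula AP → Prop
  | _, .top => True
  | T, .bot => T = ∅
  | T, .prop p => ∀ s ∈ T, p ∈ W.label s
  | T, .negProp p => ∀ s ∈ T, p ∉ W.label s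
  | T, .or φ ψ => ∃ T₁ T₂ : Set S, T = T₁ ∪ T₂ ∧ Sat W T₁ φ ∧ Sat W T₂ ψ
  | T, .cor φ ψ => Sat W T φ ∨ Sat W T ψ
  | T, .and φ ψ => Sat W T φ ∧ Sat W T ψ
  | T, .box φ => Sat W {s' | ∃ s ∈ T, W.R s s'} φ
  | T, .dia φ => ∃ T' : Set S, Sat W T' φ ∧ ∀ s ∈ T, ∃ s' ∈ T', W.R s s'
  | T, .dep ps q => ∀ s₁ ∈ T, ∀ s₂ ∈ T,
      W.label s₁ ∩ {p | p ∈ ps} ≠ W.label s₂ ∩ {p | p ∈ ps} ∨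
        W.label s₁ ∩ {q} = W.label s₂ ∩ {q}
  | T, .negDep _ _ => T = ∅

/-! ### Encoding of instances as words

Finite instances `(W, T, φ)`, with set of worlds `Fin n` and atomic propositions `Fin m`, are
written as words over a fixed finite alphabet: `n` and `m` in unary, the adjacency matrix of the
accessibility relation, the incidence matrix of the labeling function, the characteristic vector
of the team and the formula in Polish notation. Every index is smaller than the dimension of a
matrix that is part of the word, so unary indices cost only a polynomial factor. -/

/-- The alphabet of the encoding. -/
inductive Sym where
  | zero | one | sep | top | bot | prop | neg | dep | to | or | cor | and | box | dia
  deriving DecidableEq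

instance : Fintype Sym where
  elems := {.zero, .one, .sep, .top, .bot, .prop, .neg, .dep, .to, .or, .cor, .and, .box, .dia}
  complete := by intro x; cases x <;> decide

open Classical in
/-- The characteristic bits of a predicate on `Fin n`, closed by a separator. -/
noncomputable def encRow {n : ℕ} (P : Fin n → Prop) : List Sym :=
  (List.finRange n).map (fun i => if P i then Sym.one else Sym.zero) ++ [Sym.sep]

/-- A natural number in unary, closed by a separator. -/
def encNat (i : ℕ) : List Sym :=
  List.replicate i Sym.one ++ [Sym.sep]

/-- A dependence atom: the list of determining propositions, and the determined one after the
symbol `to`. -/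
def encDep {m : ℕ} (ps : List (Fin m)) (q : Fin m) : List Sym :=
  Sym.dep :: (ps.flatMap (fun p => encNat p) ++ Sym.to :: encNat q)

/-- Polish (prefix) notation of a formula. -/
def encFormula {m : ℕ} : Formula (Fin m) → List Sym
  | .top => [Sym.top]
  | .bot => [Sym.bot]
  | .prop q => Sym.prop :: encNat q
  | .negProp q => Sym.neg :: Sym.prop :: encNat q
  | .or φ ψ => Sym.or :: (encFormula φ ++ encFormula ψ)
  | .cor φ ψ => Sym.cor :: (encFormula φ ++ encFormula ψ)
  | .and φ ψ => Sym.and :: (encFormula φ ++ encFormula ψ)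
  | .box φ => Sym.box :: encFormula φ
  | .dia φ => Sym.dia :: encFormula φ
  | .dep ps q => encDep ps q
  | .negDep ps q => Sym.neg :: encDep ps q

/-- The word `⟨W, T, φ⟩`. -/
noncomputable def encInstance {n m : ℕ} (W : Kripke (Fin m) (Fin n)) (T : Set (Fin n))
    (φ : Formula (Fin m)) : List Sym :=
  encNat n ++ encNat m ++
    (List.finRange n).flatMap (fun s => encRow (fun s' => W.R s s')) ++
    (List.finRange n).flatMap (fun s => encRow (fun p => p ∈ W.label s)) ++
    encRow (fun s => s ∈ T) ++ encFormula φ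

/-- The model checking problem for a logic given by its set of formulas over every finite set
`Fin m` of atomic propositions: the language of all words `⟨W, T, φ⟩` with `φ` in the logic
and `W, T ⊨ φ`. -/
def modelChecking (logic : ∀ m : ℕ, Set (Formula (Fin m))) : Language Sym :=
  {x | ∃ (n m : ℕ) (W : Kripke (Fin m) (Fin n)) (T : Set (Fin n)) (φ : Formula (Fin m)),
    φ ∈ logic m ∧ Sat W T φ ∧ x = encInstance W T φ}

/-- The model checking problem for `MDL[M]`. -/
def MDLMC (M : Set Op) : Language Sym :=
  modelChecking (fun m => MDL (Fin m) M)

/-- The model checking problem for `MDL_k[M]`. -/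
def MDLMCk (k : ℕ) (M : Set Op) : Language Sym :=
  modelChecking (fun m => MDLk (Fin m) k M)

/-! ### The class NP -/

/-- A language over a finite alphabet is in NP if there are a polynomial `p` and a predicate `V`
on pairs of a word and a certificate (a bit string), decided by a deterministic multi-stack Turing
machine in time polynomial in the length of the pair, such that `x` is in the language iff `V`
accepts `x` with some certificate of length at most `p(|x|)`. -/
def InNP {Γ : Type} [Fintype Γ] (L : Language Γ) : Prop :=
  ∃ (p : Polynomial ℕ) (V : List Γ × List Bool → Bool),
    Nonempty (Turing.TM2ComputableInPolyTime
      (Computability.encodingProd (Computability.encodingList Γ)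
        (Computability.encodingList Bool)).encode
      Computability.encodingBoolBool.encode V) ∧
    ∀ x : List Γ, x ∈ L ↔ ∃ w : List Bool, w.length ≤ p.eval x.length ∧ V (x, w) = true

end ModalDep

/-! A certificate assigns a team to every subformula occurrence of `φ`. All the nondeterminism of
the semantics lies in the choice of teams: the split for `∨`, the successor team for `EX`, the
chosen disjunct of classical disjunction. Once the teams are fixed, `W, T ⊨ φ` follows from one
local condition `Loc` per occurrence, comparing its team with those of its immediate subformulas.
There are at most as many occurrences as letters of the word, and each team is a bit vector, so the
certificate is polynomially long.

Parsing is certified in the same way. A second table `C` marks the intervals of the word that are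
claimed to be formulas, and `Loc` compares an interval with those of its parts. Membership in
`MDL[M]` and the arity bound are local too; `fragment M K` treats both problems at once, with `K =
none` for unbounded arity. Soundness is `exists_formula_of_certificate`, completeness is
`exists_certificate`, and `mem_modelChecking_iff` combines them with the layout of the word.

For the running time, `Loc` and `Check` use only quantifiers over positions bounded by the length of
the word, letter tests, sums, products and bounded counting. Hence `isPred_verify` turns the
verifier into an `Expr`, an arithmetical expression with bounded sums. A fixed expression has
polynomially bounded values (`Expr.eval_le`), so its evaluation by nested counting loops takes
polynomial time (`Expr.exec_prog`). Loop programs are simulated step by step by a multi-stack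
machine (`Exec.steps`). `inNP_of_expr` packages this as a criterion for NP. -/

namespace ModalDep

open Turing StateTransition

/-! ### Loop programs with registers and an input tape -/

/-- Loop programs over natural number registers and a tape with letters in `Γ`. -/
inductive Prog (Γ : Type) where
  | inc (i : ℕ)
  | dec (i : ℕ)
  | right
  | left
  | drop
  | incIf (p : Γ → Bool) (i : ℕ)
  | seq (P Q : Prog Γ)
  | loop (i : ℕ) (P : Prog Γ)
  | scan (i : ℕ)

/-- States of loop programs: the reversed tape left of the head, the tape from the head on, and
the registers. -/
@[ext] structure St (Γ : Type) where
  /-- The tape left of the head, nearest letter first. -/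
  before : List Γ
  /-- The tape from the head on. -/
  after : List Γ
  /-- The registers. -/
  reg : ℕ → ℕ

variable {Γ : Type}

/-- Move the head to the right, if possible. -/
def St.moveRight : St Γ → St Γ
  | ⟨l, a :: r, S⟩ => ⟨a :: l, r, S⟩
  | ⟨l, [], S⟩ => ⟨l, [], S⟩

/-- Move the head to the left, if possible. -/
def St.moveLeft : St Γ → St Γ
  | ⟨a :: l, r, S⟩ => ⟨l, a :: r, S⟩
  | ⟨[], r, S⟩ => ⟨[], r, S⟩

/-- Set a register. -/
def St.set (s : St Γ) (i k : ℕ) : St Γ := ⟨s.before, s.after, Function.update s.reg i k⟩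

/-- `Exec P s s' t`: the program `P` leads from `s` to `s'` in time `t`. -/
inductive Exec : Prog Γ → St Γ → St Γ → ℕ → Prop
  | inc (i s) : Exec (.inc i) s (s.set i (s.reg i + 1)) 1
  | dec (i s) : Exec (.dec i) s (s.set i (s.reg i - 1)) 1
  | right (s) : Exec .right s s.moveRight 1
  | left (s) : Exec .left s s.moveLeft 1
  | drop (s) : Exec .drop s ⟨s.before, s.after.tail, s.reg⟩ 1
  | incIf (p i s) : Exec (.incIf p i) s
      (if s.after.head?.any p then s.set i (s.reg i + 1) else s) 1
  | seq {P Q s s' s'' t t'} : Exec P s s' t → Exec Q s' s'' t' → Exec (.seq P Q) s s'' (t + t')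
  | loop_zero {i P s} : s.reg i = 0 → Exec (.loop i P) s s 1
  | loop_succ {i P s s' s'' k t t'} : s.reg i = k + 1 → Exec P (s.set i k) s' t →
      Exec (.loop i P) s' s'' t' → Exec (.loop i P) s s'' (1 + t + t')
  | scan_nil {i s} : s.after = [] → Exec (.scan i) s s 1
  | scan_cons {i s s' t} : s.after ≠ [] →
      Exec (.scan i) (s.moveRight.set i (s.reg i + 1)) s' t → Exec (.scan i) s s' (1 + t)

/-- The program mentions only registers with index at most `r`. -/
def Prog.Below (r : ℕ) : Prog Γ → Prop
  | .inc i | .dec i | .incIf _ i | .scan i => i ≤ r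
  | .right | .left | .drop => True
  | .seq P Q => P.Below r ∧ Q.Below r
  | .loop i P => i ≤ r ∧ P.Below r

theorem Prog.Below.mono {r r' : ℕ} (h : r ≤ r') : ∀ {P : Prog Γ}, P.Below r → P.Below r'
  | .inc _, hP | .dec _, hP | .incIf _ _, hP | .scan _, hP => le_trans hP h
  | .right, _ | .left, _ | .drop, _ => trivial
  | .seq _ _, hP => ⟨hP.1.mono h, hP.2.mono h⟩
  | .loop _ _, hP => ⟨le_trans hP.1 h, hP.2.mono h⟩

theorem Prog.exists_below (P : Prog Γ) : ∃ r, P.Below r := by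
  induction P with
  | inc i | dec i | incIf _ i | scan i => exact ⟨i, le_rfl⟩
  | right | left | drop => exact ⟨0, trivial⟩
  | seq P Q hP hQ =>
    obtain ⟨a, ha⟩ := hP
    obtain ⟨b, hb⟩ := hQ
    exact ⟨max a b, ha.mono (le_max_left _ _), hb.mono (le_max_right _ _)⟩
  | loop i P hP =>
    obtain ⟨a, ha⟩ := hP
    exact ⟨max i a, le_max_left _ _, ha.mono (le_max_right _ _)⟩

/-! ### Compilation to stack machines -/

/-- The stacks of the compiled machine. -/
inductive Stk (r : ℕ) where
  | inp | aux | out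
  | reg (i : Fin (r + 1))
  deriving DecidableEq, Fintype

/-- The stack alphabets of the compiled machine. -/
@[reducible] def Stk.Alph (Γ : Type) {r : ℕ} : Stk r → Type
  | .inp | .aux => Γ
  | .out => Bool
  | .reg _ => Unit

/-- The labels of the compiled program. -/
@[reducible] def Prog.Lab : Prog Γ → Type
  | .seq P Q => P.Lab ⊕ Q.Lab
  | .loop _ P => Option P.Lab
  | _ => Unit

theorem Prog.finite_lab : ∀ P : Prog Γ, Finite P.Lab
  | .seq P Q => @Finite.instSum _ _ P.finite_lab Q.finite_lab
  | .loop _ P => @instFiniteOption _ P.finite_lab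
  | .inc _ | .dec _ | .right | .left | .drop | .incIf _ _ | .scan _ =>
    inferInstanceAs (Finite Unit)

/-- The first label. -/
def Prog.entry : ∀ P : Prog Γ, P.Lab
  | .seq P _ => .inl P.entry
  | .loop _ _ => none
  | .inc _ | .dec _ | .right | .left | .drop | .incIf _ _ | .scan _ => ()

open TM2.Stmt in
/-- The code of a program that continues with the label `nxt` of a machine into which the labels
of the program are embedded by `emb`. The machine state holds a letter and a truth value. -/
def Prog.code [Inhabited Γ] (r : ℕ) : ∀ (P : Prog Γ) {Λ : Type}, (P.Lab → Λ) → Λ → P.Lab →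
    TM2.Stmt (Stk.Alph Γ (r := r)) Λ (Option Γ × Bool)
  | .inc i, _, _, nxt, _ =>
    -- The reduction modulo `r + 1` is harmless: correctness is claimed only under `Below r`, where
    -- `i ≤ r`.
    push (.reg (Fin.ofNat (r + 1) i)) (fun _ => ()) (goto fun _ => nxt)
  | .dec i, _, _, nxt, _ =>
    pop (.reg (Fin.ofNat (r + 1) i)) (fun v _ => v) (goto fun _ => nxt)
  | .right, _, _, nxt, _ =>
    pop .inp (fun v o => (o, v.2)) <| branch (fun v => v.1.isSome)
      -- The default letter is never pushed, since this branch requires `v.1.isSome`.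
      (push .aux (fun v => v.1.getD default) (goto fun _ => nxt)) (goto fun _ => nxt)
  | .left, _, _, nxt, _ =>
    pop .aux (fun v o => (o, v.2)) <| branch (fun v => v.1.isSome)
      (push .inp (fun v => v.1.getD default) (goto fun _ => nxt)) (goto fun _ => nxt)
  | .drop, _, _, nxt, _ => pop .inp (fun v _ => v) (goto fun _ => nxt)
  | .incIf p i, _, _, nxt, _ =>
    peek .inp (fun v o => (o, v.2)) <| branch (fun v => v.1.any p)
      (push (.reg (Fin.ofNat (r + 1) i)) (fun _ => ()) (goto fun _ => nxt)) (goto fun _ => nxt)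
  | .seq P Q, _, emb, _, .inl l => P.code r (fun l => emb (.inl l)) (emb (.inr Q.entry)) l
  | .seq _ Q, _, emb, nxt, .inr l => Q.code r (fun l => emb (.inr l)) nxt l
  -- The label `none` is the loop test, to which the body returns. It takes one machine step per
  -- round, the `1` in `loop_zero` and `loop_succ`.
  | .loop i P, _, emb, nxt, none =>
    pop (.reg (Fin.ofNat (r + 1) i)) (fun v o => (v.1, o.isSome)) <|
      branch (fun v => v.2) (goto fun _ => emb (some P.entry)) (goto fun _ => nxt)
  | .loop _ P, _, emb, _, some l => P.code r (fun l => emb (some l)) (emb none) l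
  | .scan i, _, emb, nxt, _ =>
    pop .inp (fun v o => (o, v.2)) <| branch (fun v => v.1.isSome)
      (push .aux (fun v => v.1.getD default) <|
        push (.reg (Fin.ofNat (r + 1) i)) (fun _ => ()) (goto fun _ => emb ()))
      (goto fun _ => nxt)

/-- The stacks that represent a state. -/
def St.stk (r : ℕ) (s : St Γ) : ∀ k : Stk r, List (k.Alph Γ)
  | .inp => s.after
  | .aux => s.before
  | .out => []
  | .reg i => List.replicate (s.reg i) ()

theorem St.update_reg {r : ℕ} (s : St Γ) {i : ℕ} (hi : i ≤ r) (k : ℕ) :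
    Function.update (s.stk r) (.reg (Fin.ofNat (r + 1) i)) (List.replicate k ()) =
      (s.set i k).stk r := by
  have hv : (i % (r + 1)) = i := Nat.mod_eq_of_lt (by omega)
  funext j
  cases j with
  | inp | aux | out => rfl
  | reg j =>
    by_cases h : j = Fin.ofNat (r + 1) i
    · subst h
      simp [St.stk, St.set, hv]
    · have h' : (j : ℕ) ≠ i := fun h' => h (Fin.ext (by simp [h', hv]))
      rw [Function.update_of_ne (by simpa using h)]
      simp [St.stk, St.set, h']

theorem St.update_inp {r : ℕ} (s : St Γ) (u : List Γ) :
    Function.update (s.stk r) .inp u = (⟨s.before, u, s.reg⟩ : St Γ).stk r := by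
  funext j; cases j <;> rfl

theorem St.update_aux {r : ℕ} (s : St Γ) (u : List Γ) :
    Function.update (s.stk r) .aux u = (⟨u, s.after, s.reg⟩ : St Γ).stk r := by
  funext j; cases j <;> rfl

theorem St.stk_reg {r : ℕ} (s : St Γ) {i : ℕ} (hi : i ≤ r) :
    s.stk r (.reg (Fin.ofNat (r + 1) i)) = List.replicate (s.reg i) () := by
  simp [St.stk, Nat.mod_eq_of_lt (show i < r + 1 by omega)]

/-- `Steps f t a b`: exactly `t` steps of `f` lead from `a` to `b`. -/
def Steps {α : Type*} (f : α → Option α) (t : ℕ) (a b : α) : Prop :=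
  (flip bind f)^[t] (some a) = some b

theorem Steps.one {α : Type*} {f : α → Option α} {a b : α} (h : f a = some b) : Steps f 1 a b := h

theorem Steps.trans {α : Type*} {f : α → Option α} {t t' : ℕ} {a b c : α} (h : Steps f t a b)
    (h' : Steps f t' b c) : Steps f (t + t') a c := by
  unfold Steps at *
  rw [Nat.add_comm, Function.iterate_add_apply, h, h']

/-- Every atomic instruction and every loop test is one machine step, and sequencing costs nothing.
The induction generalizes over the label type and `emb`, because a subprogram runs inside the
machine of the whole program; it also generalizes over `v`, which is scratch space that each
instruction sets before reading. -/
theorem Exec.steps [Inhabited Γ] {r : ℕ} {P : Prog Γ} {s s' : St Γ} {t : ℕ} (h : Exec P s s' t)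
    (hP : P.Below r) {Λ : Type} {emb : P.Lab → Λ} {nxt : Λ}
    {m : Λ → TM2.Stmt (Stk.Alph Γ (r := r)) Λ (Option Γ × Bool)}
    (hm : ∀ l, m (emb l) = P.code r emb nxt l) (v : Option Γ × Bool) :
    ∃ v', Steps (TM2.step m) t ⟨some (emb P.entry), v, s.stk r⟩ ⟨some nxt, v', s'.stk r⟩ := by
  induction h generalizing v Λ with
  | inc i s =>
    refine ⟨v, .one ?_⟩
    simp only [TM2.step, hm, Prog.code, TM2.stepAux, St.stk_reg s hP, ← List.replicate_succ,
      St.update_reg s hP]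
  | dec i s =>
    refine ⟨v, .one ?_⟩
    simp only [TM2.step, hm, Prog.code, TM2.stepAux, St.stk_reg s hP, List.tail_replicate,
      St.update_reg s hP]
  | right s =>
    obtain ⟨l, u, S⟩ := s
    cases u with
    | nil => exact ⟨(none, v.2), .one (by simp [hm, Prog.code, St.stk, St.update_inp, St.moveRight])⟩
    | cons a u =>
      refine ⟨(some a, v.2), .one ?_⟩
      simp [hm, Prog.code, St.stk, St.update_inp, St.update_aux, St.moveRight]
  | left s =>
    obtain ⟨l, u, S⟩ := s
    cases l with
    | nil => exact ⟨(none, v.2), .one (by simp [hm, Prog.code, St.stk, St.update_aux, St.moveLeft])⟩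
    | cons a l =>
      refine ⟨(some a, v.2), .one ?_⟩
      simp [hm, Prog.code, St.stk, St.update_inp, St.update_aux, St.moveLeft]
  | drop s => exact ⟨v, .one (by simp [hm, Prog.code, St.stk, St.update_inp])⟩
  | incIf p i s =>
    refine ⟨(s.after.head?, v.2), .one ?_⟩
    have h : s.stk r .inp = s.after := rfl
    simp only [TM2.step, hm, Prog.code, TM2.stepAux, St.stk_reg s hP, ← List.replicate_succ,
      St.update_reg s hP, h]
    cases s.after.head?.any p <;> rfl
  | seq h h' ih ih' =>
    obtain ⟨v₁, h₁⟩ := ih hP.1 (fun l => hm (.inl l)) v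
    obtain ⟨v₂, h₂⟩ := ih' hP.2 (fun l => hm (.inr l)) v₁
    exact ⟨v₂, h₁.trans h₂⟩
  | @loop_zero i P s h =>
    refine ⟨(v.1, false), .one ?_⟩
    simp only [TM2.step, Prog.entry, hm, Prog.code, TM2.stepAux, St.stk_reg s hP.1,
      List.tail_replicate, St.update_reg s hP.1]
    -- The test pops an empty stack, so the state does not change.
    have h' : s.set i (s.reg i - 1) = s := by
      rw [h, Nat.zero_sub, ← h]
      simp [St.set]
    rw [h']
    simp [h]
  | @loop_succ i P s s' s'' k t t' hk h h' ih ih' =>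
    obtain ⟨v₁, h₁⟩ := ih hP.2 (fun l => hm (some l)) (v.1, true)
    obtain ⟨v₂, h₂⟩ := ih' hP hm v₁
    refine ⟨v₂, ((Steps.one ?_).trans h₁).trans h₂⟩
    simp only [TM2.step, Prog.entry, hm, Prog.code, TM2.stepAux, St.stk_reg s hP.1,
      List.tail_replicate, St.update_reg s hP.1]
    simp [hk, List.replicate_succ]
  | @scan_nil i s h =>
    obtain ⟨l, u, S⟩ := s
    obtain rfl : u = [] := h
    exact ⟨(none, v.2), .one (by simp [hm, Prog.code, St.stk, St.update_inp])⟩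
  | @scan_cons i s s' t h h' ih =>
    obtain ⟨l, u, S⟩ := s
    obtain ⟨a, u, rfl⟩ := List.exists_cons_of_ne_nil h
    obtain ⟨v₁, h₁⟩ := ih hP hm (some a, v.2)
    refine ⟨v₁, (Steps.one ?_).trans h₁⟩
    have hi : i ≤ r := hP
    simp only [TM2.step, hm, Prog.code, TM2.stepAux, St.moveRight]
    simp only [show St.stk r ⟨l, a :: u, S⟩ .inp = a :: u from rfl, List.head?_cons,
      Option.isSome_some, Option.getD_some, cond_true, List.tail_cons, St.update_inp]
    rw [show St.stk r ⟨l, u, S⟩ .aux = l from rfl, St.update_aux, St.stk_reg _ hi,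
      ← List.replicate_succ, St.update_reg _ hi]

open TM2.Stmt in
/-- The machine that runs a program and then outputs whether the register `o` is positive. -/
noncomputable def Prog.machine [Inhabited Γ] [Fintype Γ] (P : Prog Γ) (r o : ℕ) : FinTM2 :=
  haveI := P.finite_lab
  { K := Stk r
    k₀ := .inp
    k₁ := .out
    Γ := Stk.Alph Γ
    Λ := P.Lab ⊕ Unit
    main := .inl P.entry
    ΛFin := Fintype.ofFinite _
    σ := Option Γ × Bool
    initialState := (none, false)
    Γk₀Fin := inferInstanceAs (Fintype Γ)
    m := fun
      | .inl l => P.code r .inl (.inr ()) l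
      -- A halting configuration must have the initial internal state and all stacks empty except
      -- the output, so the pop that reads the answer also clears it and the state is reset.
      | .inr _ => pop (.reg (Fin.ofNat (r + 1) o)) (fun _ x => (none, x.isSome)) <|
          push .out (fun v => v.2) <| load (fun _ => (none, false)) halt }

/-- The program has to clean up after itself: the tape is empty at the end and the only possibly
nonzero register holds the answer as `0` or `1`. The final output step accounts for the bound `q +
1`. -/
theorem computableInPolyTime_of_exec [Inhabited Γ] [Fintype Γ] {α : Type} {enc : α → List Γ}
    {f : α → Bool} (P : Prog Γ) (o : ℕ) (q : Polynomial ℕ)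
    (h : ∀ a, ∃ t ≤ q.eval (enc a).length, Exec P ⟨[], enc a, fun _ => 0⟩
      ⟨[], [], Function.update (fun _ => 0) o (f a).toNat⟩ t) :
    Nonempty (TM2ComputableInPolyTime enc Computability.encodingBoolBool.encode f) := by
  obtain ⟨r, hr⟩ := P.exists_below
  -- The output register needs a stack even if the program does not mention it.
  replace hr : P.Below (max r o) := hr.mono (le_max_left _ _)
  have ho : o ≤ max r o := le_max_right _ _
  generalize max r o = r at hr ho
  refine ⟨⟨⟨P.machine r o, Equiv.refl _, Equiv.refl _⟩, q + 1, fun a => Nonempty.some ?_⟩⟩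
  obtain ⟨t, ht, h⟩ := h a
  obtain ⟨v, hv⟩ := h.steps hr (emb := Sum.inl) (nxt := Sum.inr ())
    (m := (P.machine r o).m) (fun l => rfl) (none, false)
  refine ⟨⟨⟨t + 1, ?_⟩, by simpa using ht⟩⟩
  refine Eq.trans (congrArg (fun c => (flip bind _)^[t + 1] (some c)) ?_)
    (Eq.trans (hv.trans (.one rfl)) (congrArg some ?_))
  · have e : (enc a).map (Equiv.refl Γ).invFun = enc a := List.map_id _
    refine congrArg (TM2.Cfg.mk _ _) (funext fun k => ?_)
    cases k with
    | inp => exact e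
    | aux | out | reg => rfl
  · refine congrArg (TM2.Cfg.mk _ _) (funext fun k => ?_)
    cases k with
    | inp | aux => rfl
    | out =>
      have e := St.stk_reg (⟨[], [], Function.update (fun _ => 0) o (f a).toNat⟩ : St Γ) ho
      change [(St.stk r _ (.reg (Fin.ofNat (r + 1) o))).head?.isSome] = [f a]
      rw [e]
      cases f a <;> simp
    | reg i =>
      change Function.update (β := fun k : Stk r => List (k.Alph Γ)) (St.stk r
        (⟨[], [], Function.update (fun _ => 0) o (f a).toNat⟩ : St Γ)) (.reg (Fin.ofNat (r + 1) o))
        (St.stk r _ (.reg (Fin.ofNat (r + 1) o))).tail (.reg i) = []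
      rw [St.stk_reg _ ho, List.tail_replicate, St.update_reg _ ho]
      have h1 : (f a).toNat - 1 = 0 := by cases f a <;> rfl
      simp [St.stk, St.set, h1]

/-! ### Programs for arithmetical expressions -/

/-- `ExecLE P s s' b`: the program `P` leads from `s` to `s'` in time at most `b`. -/
def ExecLE (P : Prog Γ) (s s' : St Γ) (b : ℕ) : Prop := ∃ t ≤ b, Exec P s s' t

theorem ExecLE.mono {P : Prog Γ} {s s' : St Γ} {b b' : ℕ} (h : ExecLE P s s' b) (hb : b ≤ b') :
    ExecLE P s s' b' :=
  let ⟨t, ht, h⟩ := h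
  ⟨t, ht.trans hb, h⟩

theorem ExecLE.seq {P Q : Prog Γ} {s s' s'' : St Γ} {b b' : ℕ} (h : ExecLE P s s' b)
    (h' : ExecLE Q s' s'' b') : ExecLE (.seq P Q) s s'' (b + b') :=
  let ⟨_, ht, h⟩ := h
  let ⟨_, ht', h'⟩ := h'
  ⟨_, Nat.add_le_add ht ht', h.seq h'⟩

/-- A loop along a sequence of states in which its register counts down. -/
theorem ExecLE.loop {P : Prog Γ} {i b : ℕ} (n : ℕ) (I : ℕ → St Γ) (hn : (I n).reg i = 0)
    (h : ∀ k < n, (I k).reg i = n - k ∧ ExecLE P ((I k).set i (n - k - 1)) (I (k + 1)) b) :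
    ExecLE (.loop i P) (I 0) (I n) (n * (b + 1) + 1) := by
  induction n generalizing I with
  | zero => exact ⟨1, by simp, .loop_zero hn⟩
  | succ n ih =>
    obtain ⟨h0, t, ht, h1⟩ := h 0 n.succ_pos
    obtain ⟨t', ht', h2⟩ := ih (fun k => I (k + 1)) hn fun k hk => by
      simpa using h (k + 1) (by omega)
    refine ⟨1 + t + t', ?_, .loop_succ (k := n) h0 h1 h2⟩
    rw [Nat.add_mul]
    omega

/-- Arithmetical expressions about a word, with de Bruijn variables for natural numbers: sums,
truncated differences, bounded sums (which bind a variable) and tests of the letter at a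
position. -/
inductive Expr (Γ : Type) where
  | var (v : ℕ)
  | one
  | add (a b : Expr Γ)
  | sub (a b : Expr Γ)
  | sum (a b : Expr Γ)
  | test (p : Γ → Bool) (a : Expr Γ)

/-- Extend an environment by a value for the variable `0`. -/
def push (i : ℕ) (env : ℕ → ℕ) : ℕ → ℕ
  | 0 => i
  | v + 1 => env v

@[simp] theorem push_zero (i : ℕ) (env : ℕ → ℕ) : push i env 0 = i := rfl

@[simp] theorem push_succ (i : ℕ) (env : ℕ → ℕ) (v : ℕ) : push i env (v + 1) = env v := rfl

/-- The value of an expression. -/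
def Expr.eval (z : List Γ) : Expr Γ → (ℕ → ℕ) → ℕ
  | .var v, env => env v
  | .one, _ => 1
  | .add a b, env => a.eval z env + b.eval z env
  | .sub a b, env => a.eval z env - b.eval z env
  | .sum a b, env => ∑ i ∈ Finset.range (a.eval z env), b.eval z (push i env)
  | .test p a, env => if z[a.eval z env]?.any p then 1 else 0

/-- A program that adds the value of an expression to the register `j`. The variable `v` is in
the register `ρ v`, and the registers after `j` are for temporary values. -/
def Expr.prog : Expr Γ → (ℕ → ℕ) → ℕ → Prog Γ
  -- A loop consumes its register, so the value is also saved in `j + 1` and then moved back.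
  | .var v, ρ, j => .seq (.loop (ρ v) (.seq (.inc j) (.inc (j + 1)))) (.loop (j + 1) (.inc (ρ v)))
  | .one, _, j => .inc j
  | .add a b, ρ, j => .seq (a.prog ρ j) (b.prog ρ j)
  | .sub a b, ρ, j => .seq (a.prog ρ (j + 1)) <| .seq (b.prog ρ (j + 2)) <|
      .seq (.loop (j + 2) (.dec (j + 1))) (.loop (j + 1) (.inc j))
  -- Register `j + 1` counts the remaining rounds, `j + 2` is the summation variable and `j + 3`
  -- receives the summand.
  | .sum a b, ρ, j => .seq (a.prog ρ (j + 1)) <|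
      .seq (.loop (j + 1) (.seq (b.prog (push (j + 2) ρ) (j + 3)) <|
        .seq (.loop (j + 3) (.inc j)) (.inc (j + 2)))) <|
        -- This only clears `j + 2`; decrementing the zero register `j + 3` is an idle body.
        .loop (j + 2) (.dec (j + 3))
  -- Register `j + 2` records the number of moves to the right, so that the head can be brought
  -- back.
  | .test p a, ρ, j => .seq (a.prog ρ (j + 1)) <|
      .seq (.loop (j + 1) (.seq .right (.inc (j + 2)))) <|
        .seq (.incIf p j) (.loop (j + 2) .left)

/-- Loops run as often as their register says, so time bounds need value bounds. In a sum the bound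
variable stays below the bound `p(B)` of the range, so the summand is evaluated in an environment
bounded by `B + p(B)`. -/
theorem Expr.eval_le (e : Expr Γ) : ∃ p : Polynomial ℕ, ∀ (z : List Γ) (env : ℕ → ℕ) (B : ℕ),
    (∀ v, env v ≤ B) → e.eval z env ≤ p.eval B := by
  induction e with
  | var v => exact ⟨.X, fun z env B h => by simpa [Expr.eval] using h v⟩
  | one => exact ⟨1, fun z env B h => by simp [Expr.eval]⟩
  | test p a _ => exact ⟨1, fun z env B h => by simp only [Expr.eval]; split_ifs <;> simp⟩
  | add a b iha ihb =>
    obtain ⟨p, hp⟩ := iha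
    obtain ⟨q, hq⟩ := ihb
    exact ⟨p + q, fun z env B h => by
      simpa [Expr.eval] using Nat.add_le_add (hp z env B h) (hq z env B h)⟩
  | sub a b iha _ =>
    obtain ⟨p, hp⟩ := iha
    exact ⟨p, fun z env B h => (Nat.sub_le _ _).trans (hp z env B h)⟩
  | sum a b iha ihb =>
    obtain ⟨p, hp⟩ := iha
    obtain ⟨q, hq⟩ := ihb
    refine ⟨p * q.comp (.X + p), fun z env B h => ?_⟩
    have ha := hp z env B h
    have hb : ∀ i ∈ Finset.range (a.eval z env), b.eval z (push i env) ≤ q.eval (B + p.eval B) := by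
      intro i hi
      refine hq z _ _ fun v => ?_
      cases v with
      | zero => exact ((Finset.mem_range.1 hi).le.trans ha).trans (Nat.le_add_left _ _)
      | succ v => exact (h v).trans (Nat.le_add_right _ _)
    calc ∑ i ∈ Finset.range (a.eval z env), b.eval z (push i env)
        ≤ a.eval z env * q.eval (B + p.eval B) := by simpa using Finset.sum_le_card_nsmul _ _ _ hb
      _ ≤ p.eval B * q.eval (B + p.eval B) := Nat.mul_le_mul_right _ ha
      _ = _ := by simp

theorem ExecLE.cast {P : Prog Γ} {s s' s'' : St Γ} {b b' : ℕ} (h : ExecLE P s s' b) (hs : s' = s'')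
    (hb : b ≤ b') : ExecLE P s s'' b' :=
  hs ▸ h.mono hb

theorem ExecLE.cast' {P : Prog Γ} {s₀ s s' s'' : St Γ} {b b' : ℕ} (h : ExecLE P s s' b)
    (hs₀ : s = s₀) (hs : s' = s'') (hb : b ≤ b') : ExecLE P s₀ s'' b' :=
  hs₀ ▸ hs ▸ h.mono hb

theorem ExecLE.inc (i : ℕ) (s : St Γ) : ExecLE (.inc i) s (s.set i (s.reg i + 1)) 1 :=
  ⟨1, le_rfl, .inc i s⟩

theorem ExecLE.dec (i : ℕ) (s : St Γ) : ExecLE (.dec i) s (s.set i (s.reg i - 1)) 1 :=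
  ⟨1, le_rfl, .dec i s⟩

/-- Add a register to another one and clear it. -/
theorem ExecLE.move {i j : ℕ} (hij : i ≠ j) (l r : List Γ) (S : ℕ → ℕ) :
    ExecLE (.loop i (.inc j)) ⟨l, r, S⟩
      ⟨l, r, Function.update (Function.update S j (S j + S i)) i 0⟩ (S i * 2 + 1) := by
  refine (ExecLE.loop (i := i) (b := 1) (S i) (fun k => ⟨l, r, Function.update
    (Function.update S j (S j + k)) i (S i - k)⟩) (by simp) fun k hk =>
    ⟨by simp, (ExecLE.inc j _).cast ?_ le_rfl⟩).cast' ?_ ?_ le_rfl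
  · ext x <;> simp [St.set, Function.update_apply]
    grind
  · ext x <;> simp [Function.update_apply]
    grind
  · simp

theorem ExecLE.copy {i j : ℕ} (hij : i < j) (l r : List Γ) (S : ℕ → ℕ) (hS : S (j + 1) = 0) :
    ExecLE (.seq (.loop i (.seq (.inc j) (.inc (j + 1)))) (.loop (j + 1) (.inc i))) ⟨l, r, S⟩
      ⟨l, r, Function.update S j (S j + S i)⟩ (S i * 5 + 2) := by
  have h := ExecLE.loop (P := .seq (.inc j) (.inc (j + 1))) (i := i) (b := 2) (S i)
    (fun k => (⟨l, r, Function.update (Function.update (Function.update S j (S j + k)) (j + 1) k)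
      i (S i - k)⟩ : St Γ)) (by simp) fun k hk =>
    ⟨by simp, ((ExecLE.inc j _).seq (ExecLE.inc (j + 1) _)).cast (by
      ext x <;> simp [St.set, Function.update_apply]
      grind) le_rfl⟩
  refine (h.seq (ExecLE.move (by omega) l r _)).cast' ?_ ?_ ?_
  · ext x <;> simp [Function.update_apply]
    grind
  · ext x <;> simp [Function.update_apply]
    grind
  · simp [Function.update_apply]
    grind

theorem ExecLE.right (s : St Γ) : ExecLE .right s s.moveRight 1 := ⟨1, le_rfl, .right s⟩

theorem ExecLE.left (s : St Γ) : ExecLE .left s s.moveLeft 1 := ⟨1, le_rfl, .left s⟩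

theorem ExecLE.drop (s : St Γ) : ExecLE .drop s ⟨s.before, s.after.tail, s.reg⟩ 1 :=
  ⟨1, le_rfl, .drop s⟩

/-- The state with the head at position `k` of the word `z`. -/
def St.head (z : List Γ) (k : ℕ) (S : ℕ → ℕ) : St Γ := ⟨(z.take k).reverse, z.drop k, S⟩

theorem St.head_min (z : List Γ) (k : ℕ) (S : ℕ → ℕ) :
    St.head z (min k z.length) S = St.head z k S := by
  rcases le_total k z.length with h | h
  · rw [min_eq_left h]
  · simp [St.head, h]

theorem St.moveRight_head (z : List Γ) (k : ℕ) (S : ℕ → ℕ) :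
    St.moveRight ⟨(z.take k).reverse, z.drop k, S⟩ =
      ⟨(z.take (k + 1)).reverse, z.drop (k + 1), S⟩ := by
  by_cases h : k < z.length
  · have e : z.take (k + 1) = z.take k ++ [z[k]] := by simp
    rw [List.drop_eq_getElem_cons h, e]
    simp only [St.moveRight, List.reverse_append, List.reverse_singleton, List.singleton_append]
  · have h1 : z.length ≤ k := by omega
    have h2 : z.length ≤ k + 1 := by omega
    rw [List.drop_eq_nil_of_le h1, List.drop_eq_nil_of_le h2, List.take_of_length_le h1,
      List.take_of_length_le h2]
    rfl

theorem St.moveLeft_head {z : List Γ} {k : ℕ} (hk : k ≤ z.length) (S : ℕ → ℕ) :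
    St.moveLeft ⟨(z.take k).reverse, z.drop k, S⟩ =
      ⟨(z.take (k - 1)).reverse, z.drop (k - 1), S⟩ := by
  cases k with
  | zero => simp [St.moveLeft]
  | succ k =>
    have h : k < z.length := hk
    have e : z.take (k + 1) = z.take k ++ [z[k]] := by simp
    rw [Nat.add_sub_cancel, List.drop_eq_getElem_cons h, e]
    simp only [St.moveLeft, List.reverse_append, List.reverse_singleton, List.singleton_append]

theorem update_comp_of_lt {S ρ : ℕ → ℕ} {j : ℕ} (hρ : ∀ v, ρ v < j) (x : ℕ) {j' : ℕ} (hj : j ≤ j') :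
    Function.update S j' x ∘ ρ = S ∘ ρ := by
  funext v
  have := hρ v
  simp [Function.update_apply]
  omega

/-- Variables live below `j` and scratch registers above `j`. The latter start and end at zero and
the head returns to the start, so programs can be nested. The polynomial depends on the expression
alone, as the induction through sums requires. -/
theorem Expr.exec_prog (e : Expr Γ) : ∃ q : Polynomial ℕ, ∀ (ρ : ℕ → ℕ) (j : ℕ) (z : List Γ)
    (S : ℕ → ℕ) (B : ℕ), (∀ v, ρ v < j) → (∀ i, j < i → S i = 0) → (∀ v, S (ρ v) ≤ B) →
    ExecLE (e.prog ρ j) ⟨[], z, S⟩ ⟨[], z, Function.update S j (S j + e.eval z (S ∘ ρ))⟩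
      (q.eval B) := by
  induction e with
  | var v =>
    refine ⟨.X * 5 + 2, fun ρ j z S B hρ hS hB => ?_⟩
    refine (ExecLE.copy (hρ v) [] z S (hS _ (by omega))).mono ?_
    have := hB v
    simp
    omega
  | one => exact ⟨1, fun ρ j z S B hρ hS hB => (ExecLE.inc j _).mono (by simp)⟩
  | add a b iha ihb =>
    obtain ⟨p, hp⟩ := iha
    obtain ⟨q, hq⟩ := ihb
    refine ⟨p + q, fun ρ j z S B hρ hS hB => ?_⟩
    refine ((hp ρ j z S B hρ hS hB).seq (hq ρ j z _ B hρ (fun i hi => ?_) fun v => ?_)).cast ?_ ?_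
    · simp [hi.ne', hS i hi]
    · simpa [(hρ v).ne] using hB v
    · rw [update_comp_of_lt hρ _ le_rfl]
      simp [Expr.eval, Nat.add_assoc]
    · simp
  | sub a b iha ihb =>
    obtain ⟨p, hp⟩ := iha
    obtain ⟨q, hq⟩ := ihb
    obtain ⟨pa, hpa⟩ := a.eval_le
    obtain ⟨pb, hpb⟩ := b.eval_le
    refine ⟨p + q + (2 * pb + 1) + (2 * pa + 1), fun ρ j z S B hρ hS hB => ?_⟩
    have ha := hp ρ (j + 1) z S B (fun v => (hρ v).trans (by omega)) (fun i hi => hS i (by omega)) hB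
    have hb := hq ρ (j + 2) z (Function.update S (j + 1) (S (j + 1) + a.eval z (S ∘ ρ))) B
      (fun v => (hρ v).trans (by omega)) (fun i hi => by simp [Function.update_apply]; grind)
      (fun v => by have := hρ v; have := hB v; simp [Function.update_apply]; grind)
    rw [update_comp_of_lt hρ _ (by omega)] at hb
    have hva := hpa z (S ∘ ρ) B hB
    have hvb := hpb z (S ∘ ρ) B hB
    simp only [Expr.eval, Expr.prog]
    generalize a.eval z (S ∘ ρ) = va at *
    generalize b.eval z (S ∘ ρ) = vb at *
    have hl := ExecLE.loop (P := .dec (j + 1)) (i := j + 2) (b := 1) vb (fun k => (⟨[], z,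
      Function.update (Function.update S (j + 1) (va - k)) (j + 2) (vb - k)⟩ : St Γ)) (by simp)
      fun k hk => ⟨by simp, (ExecLE.dec (j + 1) _).cast (by
        ext x <;> simp [St.set, Function.update_apply]
        grind) le_rfl⟩
    refine (ha.seq (hb.seq ((hl.cast' ?_ rfl le_rfl).seq
      (ExecLE.move (by omega) _ _ _)))).cast ?_ ?_
    · have h1 := hS (j + 1) (by omega)
      have h2 := hS (j + 2) (by omega)
      ext x <;> simp [Function.update_apply]
      grind
    · have h1 := hS (j + 1) (by omega)
      have h2 := hS (j + 2) (by omega)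
      ext x <;> simp [Function.update_apply]
      grind
    · simp
      omega
  | sum a b iha ihb =>
    obtain ⟨p, hp⟩ := iha
    obtain ⟨q, hq⟩ := ihb
    obtain ⟨pa, hpa⟩ := a.eval_le
    obtain ⟨pb, hpb⟩ := b.eval_le
    refine ⟨p + ((pa * (q.comp (.X + pa) + (pb.comp (.X + pa) * 2 + 1 + 1) + 1) + 1) +
      (pa * (1 + 1) + 1)), fun ρ j z S B hρ hS hB => ?_⟩
    have ha := hp ρ (j + 1) z S B (fun v => (hρ v).trans (by omega)) (fun i hi => hS i (by omega)) hB
    have hva := hpa z (S ∘ ρ) B hB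
    simp only [Expr.eval, Expr.prog]
    generalize a.eval z (S ∘ ρ) = va at *
    have h1 := hS (j + 1) (by omega)
    have h2 := hS (j + 2) (by omega)
    have h3 := hS (j + 3) (by omega)
    have h4 := hS (j + 4) (by omega)
    -- Invariant after `k` rounds: `va - k` rounds remain, the summation variable is `k`, and `j`
    -- has gained the first `k` summands.
    have hl := ExecLE.loop (P := .seq (b.prog (push (j + 2) ρ) (j + 3)) <|
        .seq (.loop (j + 3) (.inc j)) (.inc (j + 2))) (i := j + 1)
      (b := q.eval (B + pa.eval B) + (pb.eval (B + pa.eval B) * 2 + 1 + 1)) va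
      (fun k => (⟨[], z, Function.update (Function.update (Function.update S (j + 1) (va - k))
        (j + 2) k) j (S j + ∑ i ∈ Finset.range k, b.eval z (push i (S ∘ ρ)))⟩ : St Γ))
      (by simp) fun k hk => ⟨by simp, ?_⟩
    · have hd := ExecLE.loop (P := .dec (j + 3)) (i := j + 2) (b := 1) va (fun k => (⟨[], z,
        Function.update (Function.update S (j + 2) (va - k)) j
          (S j + ∑ i ∈ Finset.range va, b.eval z (push i (S ∘ ρ)))⟩ : St Γ))
        (by simp)
        fun k hk => ⟨by simp, (ExecLE.dec (j + 3) _).cast (by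
          ext x <;> simp [St.set, Function.update_apply]
          grind) le_rfl⟩
      refine (ha.seq ((hl.cast' ?_ ?_ le_rfl).seq hd)).cast ?_ ?_
      · ext x <;> simp [Function.update_apply]
        grind
      · ext x <;> simp [Function.update_apply]
        grind
      · ext x <;> simp [Function.update_apply]
        grind
      · simp only [Polynomial.eval_add, Polynomial.eval_mul, Polynomial.eval_comp,
          Polynomial.eval_X, Polynomial.eval_one, Polynomial.eval_ofNat]
        gcongr
    · have hk' : ∀ v, push k (S ∘ ρ) v ≤ B + pa.eval B := by
        rintro (_ | v)
        · exact (hk.le.trans hva).trans (Nat.le_add_left _ _)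
        · exact (hB v).trans (Nat.le_add_right _ _)
      have hc : Function.update (Function.update (Function.update S (j + 1) (va - k - 1))
          (j + 2) k) j (S j + ∑ i ∈ Finset.range k, b.eval z (push i (S ∘ ρ))) ∘ push (j + 2) ρ =
          push k (S ∘ ρ) := by
        funext v
        cases v with
        | zero => simp
        | succ v =>
          have := hρ v
          simp [Function.update_apply]
          grind
      have hb := hq (push (j + 2) ρ) (j + 3) z (Function.update (Function.update (Function.update S
        (j + 1) (va - k - 1)) (j + 2) k) j
        (S j + ∑ i ∈ Finset.range k, b.eval z (push i (S ∘ ρ)))) (B + pa.eval B)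
        (by rintro (_ | v) <;> simp; have := hρ v; omega)
        (fun i hi => by simp [Function.update_apply]; grind)
        (fun v => (congrFun hc v).trans_le (hk' v))
      rw [hc] at hb
      have hvb := hpb z _ _ hk'
      rw [Finset.sum_range_succ]
      generalize b.eval z (push k (S ∘ ρ)) = vb at *
      refine (hb.seq ((ExecLE.move (by omega) _ _ _).seq (ExecLE.inc (j + 2) _))).cast' ?_ ?_ ?_
      · ext x <;> simp [St.set, Function.update_apply]
        grind
      · ext x <;> simp [St.set, Function.update_apply]
        grind
      · simp
        omega
  | test p a iha =>
    obtain ⟨q, hq⟩ := iha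
    obtain ⟨pa, hpa⟩ := a.eval_le
    refine ⟨q + ((pa * (1 + 1 + 1) + 1) + (1 + (pa * (1 + 1) + 1))), fun ρ j z S B hρ hS hB => ?_⟩
    have ha := hq ρ (j + 1) z S B (fun v => (hρ v).trans (by omega)) (fun i hi => hS i (by omega)) hB
    have hva := hpa z (S ∘ ρ) B hB
    simp only [Expr.eval, Expr.prog]
    generalize a.eval z (S ∘ ρ) = va at *
    have h1 := hS (j + 1) (by omega)
    have h2 := hS (j + 2) (by omega)
    have hr := ExecLE.loop (P := .seq .right (.inc (j + 2))) (i := j + 1) (b := 1 + 1) va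
      (fun k => St.head z k (Function.update (Function.update S (j + 1) (va - k)) (j + 2) k))
      (by simp [St.head]) fun k hk => ⟨by simp [St.head],
        ((ExecLE.right _).seq (ExecLE.inc (j + 2) _)).cast (by
          simp only [St.head, St.set, St.moveRight_head]
          congr 1
          ext x
          simp [Function.update_apply]
          grind) le_rfl⟩
    have hi : ExecLE (.incIf p j) (St.head z va (Function.update S (j + 2) va))
        (St.head z va (Function.update (Function.update S (j + 2) va) j
          (S j + if z[va]?.any p then 1 else 0))) 1 :=
      ⟨1, le_rfl, by
        convert Exec.incIf p j (St.head z va (Function.update S (j + 2) va)) using 1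
        simp only [St.head, List.head?_drop]
        split_ifs <;> simp [St.set]⟩
    generalize (if z[va]?.any p then 1 else 0) = c at *
    -- Moves to the right stop at the end of the word, so the way back starts at `min va z.length`;
    -- surplus moves to the left have no effect.
    have hl := ExecLE.loop (P := .left) (i := j + 2) (b := 1) va
      (fun k => St.head z (min va z.length - k)
        (Function.update (Function.update S (j + 2) (va - k)) j (S j + c)))
      (by simp [St.head]) fun k hk =>
        ⟨by simp [St.head], (ExecLE.left _).cast (by
          simp only [St.head, St.set]
          rw [St.moveLeft_head (by omega), Nat.sub_sub]
          congr 1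
          ext x
          simp [Function.update_apply]
          grind) le_rfl⟩
    refine (ha.seq ((hr.cast' ?_ ?_ le_rfl).seq (hi.seq (hl.cast' ?_ ?_ le_rfl)))).cast rfl ?_
    · simp only [St.head, List.take_zero, List.drop_zero, List.reverse_nil]
      congr 1
      ext x
      simp [Function.update_apply]
      grind
    · simp only [St.head]
      congr 1
      ext x
      simp [Function.update_apply]
      grind
    · rw [Nat.sub_zero, St.head_min]
      simp only [St.head]
      congr 1
    · rw [Nat.sub_eq_zero_of_le (min_le_left _ _)]
      simp only [St.head, List.take_zero, List.drop_zero, List.reverse_nil]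
      congr 1
      ext x
      simp [Function.update_apply]
      grind
    · simp only [Polynomial.eval_add, Polynomial.eval_mul, Polynomial.eval_one]
      gcongr

theorem ExecLE.scan (i : ℕ) (u l : List Γ) (S : ℕ → ℕ) : ExecLE (.scan i) ⟨l, u, S⟩
    ⟨u.reverse ++ l, [], Function.update S i (S i + u.length)⟩ (u.length + 1) := by
  induction u generalizing l S with
  | nil => exact ⟨1, by simp, by simpa using Exec.scan_nil (i := i) (s := ⟨l, [], S⟩) rfl⟩
  | cons a u ih =>
    obtain ⟨t, ht, h⟩ := ih (a :: l) (Function.update S i (S i + 1))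
    refine ⟨1 + t, by simp only [List.length_cons]; omega, ?_⟩
    convert Exec.scan_cons (i := i) (s := ⟨l, a :: u, S⟩) (by simp) h using 2
    · simp
    · simp only [Function.update_self, Function.update_idem, List.length_cons]
      congr 1
      omega

/-- A program that evaluates an expression in the environment that assigns the length of the word
to every variable, and then clears everything but the register `2` with the value. -/
def Expr.mainProg (e : Expr Γ) : Prog Γ :=
  -- The scan leaves the length in register `0` and the head at the end; the return trip transfers
  -- the length to register `1`, which serves every variable and later counts the letters to drop.
  .seq (.scan 0) <| .seq (.loop 0 (.seq .left (.inc 1))) <| .seq (e.prog (fun _ => 1) 2)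
    (.loop 1 .drop)

theorem Expr.exec_mainProg (e : Expr Γ) : ∃ q : Polynomial ℕ, ∀ z : List Γ,
    ExecLE e.mainProg ⟨[], z, fun _ => 0⟩
      ⟨[], [], Function.update (fun _ => 0) 2 (e.eval z fun _ => z.length)⟩ (q.eval z.length) := by
  obtain ⟨q, hq⟩ := e.exec_prog
  refine ⟨(.X + 1) + ((.X * (1 + 1 + 1) + 1) + (q + (.X * (1 + 1) + 1))), fun z => ?_⟩
  have h1 := ExecLE.scan 0 z [] (fun _ => 0)
  have h2 := ExecLE.loop (P := .seq .left (.inc 1)) (i := 0) (b := 1 + 1) z.length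
    (fun k => St.head z (z.length - k)
      (Function.update (Function.update (fun _ => 0) 0 (z.length - k)) 1 k))
    (by simp [St.head]) fun k hk => ⟨by simp [St.head],
      ((ExecLE.left _).seq (ExecLE.inc 1 _)).cast (by
        simp only [St.head, St.set]
        rw [St.moveLeft_head (by omega), Nat.sub_sub]
        congr 1
        ext x
        simp [Function.update_apply]
        grind) le_rfl⟩
  have h3 := hq (fun _ => 1) 2 z (Function.update (fun _ => 0) 1 z.length) z.length
    (fun _ => by simp) (fun i hi => by simp [Function.update_apply]; omega) (fun _ => by simp)
  have hc : Function.update (fun _ => 0) 1 z.length ∘ (fun _ : ℕ => 1) = fun _ => z.length := by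
    ext; simp
  rw [hc] at h3
  generalize e.eval z (fun _ => z.length) = c at *
  have h4 := ExecLE.loop (P := .drop) (i := 1) (b := 1) z.length (fun k => (⟨[], z.drop k,
    Function.update (Function.update (fun _ => 0) 2 c) 1 (z.length - k)⟩ : St Γ)) (by simp)
    fun k hk => ⟨by simp, (ExecLE.drop _).cast (by simp [St.set, Nat.sub_sub]) le_rfl⟩
  refine (h1.seq ((h2.cast' ?_ ?_ le_rfl).seq (h3.seq (h4.cast' ?_ rfl le_rfl)))).cast ?_ ?_
  · simp only [St.head]
    ext x <;> simp [Function.update_apply]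
    grind
  · simp only [St.head]
    ext x <;> simp [Function.update_apply]
  · ext x <;> simp [Function.update_apply]
    grind
  · ext x <;> simp [Function.update_apply]
    grind
  · simp

/-- A language is in NP if membership is witnessed by short bit strings for which an expression
about the word and the bit string is nonzero. -/
theorem inNP_of_expr {Δ : Type} [Fintype Δ] {L : Language Δ} (e : Expr (Δ ⊕ Bool))
    (p : Polynomial ℕ) (h : ∀ x : List Δ, x ∈ L ↔ ∃ w : List Bool, w.length ≤ p.eval x.length ∧
      e.eval (x.map .inl ++ w.map .inr) (fun _ => x.length + w.length) ≠ 0) : InNP L := by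
  -- The truncated difference `1 - (1 - e)` is `1` if `e` is nonzero and `0` otherwise.
  obtain ⟨q, hq⟩ := (Expr.sub .one (.sub .one e)).exec_mainProg
  have : Inhabited (Δ ⊕ Bool) := ⟨.inr true⟩
  refine ⟨p, fun a => decide (e.eval (a.1.map Sum.inl ++ a.2.map Sum.inr)
    (fun _ => a.1.length + a.2.length) ≠ 0), computableInPolyTime_of_exec
      (Expr.sub .one (.sub .one e)).mainProg 2 q fun a => ?_, fun x => by simp [h x]⟩
  have hv : (decide (e.eval (a.1.map Sum.inl ++ a.2.map Sum.inr)
      (fun _ => a.1.length + a.2.length) ≠ 0)).toNat = (Expr.sub .one (.sub .one e)).eval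
        (a.1.map Sum.inl ++ a.2.map Sum.inr) fun _ => (a.1.map Sum.inl ++ a.2.map Sum.inr).length := by
    simp only [Expr.eval, List.length_append, List.length_map]
    generalize e.eval _ _ = c
    cases c <;> simp
  rw [hv]
  exact hq (a.1.map Sum.inl ++ a.2.map Sum.inr)

/-! ### Definable functions and predicates -/

/-- The function is given by an expression. -/
def IsExpr (f : List Γ → (ℕ → ℕ) → ℕ) : Prop := ∃ e : Expr Γ, ∀ z env, e.eval z env = f z env

/-- The predicate is given by an expression, nonzero values meaning truth. -/
def IsPred (P : List Γ → (ℕ → ℕ) → Prop) : Prop := ∃ e : Expr Γ, ∀ z env, e.eval z env ≠ 0 ↔ P z env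

/-- Rename the variables of an expression. -/
def Expr.rename : Expr Γ → (ℕ → ℕ) → Expr Γ
  | .var v, f => .var (f v)
  | .one, _ => .one
  | .add a b, f => .add (a.rename f) (b.rename f)
  | .sub a b, f => .sub (a.rename f) (b.rename f)
  -- The bound variable `0` is kept and the free ones are shifted past it.
  | .sum a b, f => .sum (a.rename f) (b.rename (push 0 fun v => f v + 1))
  | .test p a, f => .test p (a.rename f)

theorem Expr.eval_rename (z : List Γ) (e : Expr Γ) (f env : ℕ → ℕ) :
    (e.rename f).eval z env = e.eval z (env ∘ f) := by
  induction e generalizing f env with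
  | var v => rfl
  | one => rfl
  | add a b iha ihb => simp [Expr.rename, Expr.eval, iha, ihb]
  | sub a b iha ihb => simp [Expr.rename, Expr.eval, iha, ihb]
  | test p a iha => simp [Expr.rename, Expr.eval, iha]
  | sum a b iha ihb =>
    simp only [Expr.rename, Expr.eval, iha, ihb]
    refine Finset.sum_congr rfl fun i _ => congrArg _ (funext fun v => ?_)
    cases v <;> rfl

namespace IsExpr

variable {f g : List Γ → (ℕ → ℕ) → ℕ}

theorem var (v : ℕ) : IsExpr (Γ := Γ) fun _ env => env v := ⟨.var v, fun _ _ => rfl⟩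

theorem add (hf : IsExpr f) (hg : IsExpr g) : IsExpr fun z env => f z env + g z env :=
  let ⟨a, ha⟩ := hf
  let ⟨b, hb⟩ := hg
  ⟨.add a b, fun z env => by simp [Expr.eval, ha, hb]⟩

theorem sub (hf : IsExpr f) (hg : IsExpr g) : IsExpr fun z env => f z env - g z env :=
  let ⟨a, ha⟩ := hf
  let ⟨b, hb⟩ := hg
  ⟨.sub a b, fun z env => by simp [Expr.eval, ha, hb]⟩

/-- A product is a bounded sum of a constant; the shift keeps the second factor independent of the
bound variable. -/
theorem mul (hf : IsExpr f) (hg : IsExpr g) : IsExpr fun z env => f z env * g z env :=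
  let ⟨a, ha⟩ := hf
  let ⟨b, hb⟩ := hg
  ⟨.sum a (b.rename (· + 1)), fun z env => by
    simp [Expr.eval, Expr.eval_rename, ha, hb, Function.comp_def]⟩

theorem const (c : ℕ) : IsExpr (Γ := Γ) fun _ _ => c := by
  induction c with
  | zero => exact ⟨.sub .one .one, fun _ _ => rfl⟩
  | succ c ih => exact ih.add ⟨.one, fun _ _ => rfl⟩

theorem card {P : List Γ → (ℕ → ℕ) → ℕ → Prop} [∀ z env, DecidablePred (P z env)] (hf : IsExpr f)
    (hP : IsPred fun z env => P z (fun v => env (v + 1)) (env 0)) :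
    IsExpr fun z env => ((Finset.range (f z env)).filter fun i => P z env i).card :=
  let ⟨a, ha⟩ := hf
  let ⟨b, hb⟩ := hP
  ⟨.sum a (.sub .one (.sub .one b)), fun z env => by
    beta_reduce
    rw [Finset.card_filter]
    simp only [Expr.eval, ha]
    refine Finset.sum_congr rfl fun i _ => ?_
    have h : _ ↔ P z env i := hb z (push i env)
    rw [← if_congr h rfl rfl]
    split_ifs <;> omega⟩

end IsExpr

namespace IsPred

variable {f g : List Γ → (ℕ → ℕ) → ℕ} {P Q : List Γ → (ℕ → ℕ) → Prop}

theorem lt (hf : IsExpr f) (hg : IsExpr g) : IsPred fun z env => f z env < g z env :=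
  let ⟨e, he⟩ := hg.sub hf
  ⟨e, fun z env => by rw [he]; beta_reduce; omega⟩

theorem not (hP : IsPred P) : IsPred fun z env => ¬P z env :=
  let ⟨a, ha⟩ := hP
  ⟨.sub .one a, fun z env => by beta_reduce; rw [← ha]; simp only [Expr.eval]; omega⟩

theorem and (hP : IsPred P) (hQ : IsPred Q) : IsPred fun z env => P z env ∧ Q z env :=
  let ⟨a, ha⟩ := hP
  let ⟨b, hb⟩ := hQ
  let ⟨e, he⟩ := IsExpr.mul ⟨a, fun _ _ => rfl⟩ ⟨b, fun _ _ => rfl⟩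
  ⟨e, fun z env => by beta_reduce; rw [← ha, ← hb, he]; exact mul_ne_zero_iff⟩

theorem or (hP : IsPred P) (hQ : IsPred Q) : IsPred fun z env => P z env ∨ Q z env := by
  simpa only [not_and_or, not_not] using (hP.not.and hQ.not).not

theorem imp (hP : IsPred P) (hQ : IsPred Q) : IsPred fun z env => P z env → Q z env := by
  simpa only [← imp_iff_not_or] using hP.not.or hQ

theorem iff (hP : IsPred P) (hQ : IsPred Q) : IsPred fun z env => P z env ↔ Q z env := by
  simpa only [← iff_iff_implies_and_implies] using (hP.imp hQ).and (hQ.imp hP)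

theorem le (hf : IsExpr f) (hg : IsExpr g) : IsPred fun z env => f z env ≤ g z env := by
  simpa only [not_lt] using (lt hg hf).not

theorem eq (hf : IsExpr f) (hg : IsExpr g) : IsPred fun z env => f z env = g z env := by
  simpa only [← le_antisymm_iff] using (le hf hg).and (le hg hf)

theorem const (p : Prop) : IsPred (Γ := Γ) fun _ _ => p := by
  by_cases h : p
  · exact ⟨.one, fun _ _ => by simp [h, Expr.eval]⟩
  · exact ⟨.sub .one .one, fun _ _ => by simp [h, Expr.eval]⟩

/-- A sum of natural numbers is nonzero iff some summand is. -/
theorem ex {P : List Γ → (ℕ → ℕ) → ℕ → Prop} (hf : IsExpr f)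
    (hP : IsPred fun z env => P z (fun v => env (v + 1)) (env 0)) :
    IsPred fun z env => ∃ i < f z env, P z env i :=
  let ⟨a, ha⟩ := hf
  let ⟨b, hb⟩ := hP
  ⟨.sum a b, fun z env => by
    have h (i : ℕ) : _ ↔ P z env i := hb z (push i env)
    simp only [Expr.eval, ha, ← h]
    simp⟩

theorem all {P : List Γ → (ℕ → ℕ) → ℕ → Prop} (hf : IsExpr f)
    (hP : IsPred fun z env => P z (fun v => env (v + 1)) (env 0)) :
    IsPred fun z env => ∀ i < f z env, P z env i := by
  simpa only [not_exists, not_and, not_not] using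
    (ex (P := fun z env i => ¬P z env i) hf hP.not).not

theorem test (p : Γ → Bool) (hf : IsExpr f) : IsPred fun z env => z[f z env]?.any p :=
  let ⟨a, ha⟩ := hf
  ⟨.test p a, fun z env => by simp [Expr.eval, ha]⟩

theorem letter [DecidableEq Γ] (c : Γ) (hf : IsExpr f) :
    IsPred fun z env => z[f z env]? = some c := by
  have h (o : Option Γ) : o.any (fun a => decide (a = c)) ↔ o = some c := by cases o <;> simp
  simpa only [h] using test (fun a => decide (a = c)) hf

end IsPred

/-! ### Reading words position by position -/

variable {L : ℕ → Sym → Prop}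

/-- The word `u` is written at position `p`, where `L i a` means that the letter `a` is at
position `i`. -/
def At (L : ℕ → Sym → Prop) : ℕ → List Sym → Prop
  | _, [] => True
  | p, a :: u => L p a ∧ At L (p + 1) u

@[simp] theorem at_nil (p : ℕ) : At L p [] := trivial

@[simp] theorem at_cons {p : ℕ} {a : Sym} {u : List Sym} :
    At L p (a :: u) ↔ L p a ∧ At L (p + 1) u := Iff.rfl

@[simp] theorem at_append {p : ℕ} {u v : List Sym} :
    At L p (u ++ v) ↔ At L p u ∧ At L (p + u.length) v := by
  induction u generalizing p with
  | nil => simp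
  | cons a u ih => simp [ih, and_assoc, Nat.add_assoc, Nat.add_comm 1]

theorem at_getElem? {x u : List Sym} {p : ℕ} :
    At (fun i a => x[i]? = some a) p u ↔ u <+: x.drop p := by
  induction u generalizing p with
  | nil => simp
  | cons a u ih =>
    rw [at_cons, ih]
    constructor
    · rintro ⟨h, h'⟩
      obtain ⟨hp, rfl⟩ := List.getElem?_eq_some_iff.1 h
      rw [List.drop_eq_getElem_cons hp]
      exact (List.prefix_cons_inj _).2 h'
    · intro h
      have hp : p < x.length := by
        by_contra hp
        rw [List.drop_eq_nil_of_le (by omega)] at h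
        simp at h
      rw [List.drop_eq_getElem_cons hp, List.cons_prefix_cons] at h
      exact ⟨by rw [List.getElem?_eq_getElem hp, h.1], h.2⟩

theorem at_map_finRange {n p : ℕ} {f : Fin n → Sym} :
    At L p ((List.finRange n).map f) ↔ ∀ i : Fin n, L (p + i) (f i) := by
  induction n generalizing p with
  | zero => simp
  | succ n ih =>
    simp [List.finRange_succ, Function.comp_def, ih, Fin.forall_fin_succ, Nat.add_assoc,
      Nat.add_comm 1]

theorem length_flatMap_finRange {n c : ℕ} {f : Fin n → List Sym} (h : ∀ i, (f i).length = c) :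
    ((List.finRange n).flatMap f).length = n * c := by
  simp [List.length_flatMap, h]

theorem at_flatMap_finRange {n p c : ℕ} {f : Fin n → List Sym} (h : ∀ i, (f i).length = c) :
    At L p ((List.finRange n).flatMap f) ↔ ∀ i : Fin n, At L (p + i * c) (f i) := by
  induction n generalizing p with
  | zero => simp
  | succ n ih =>
    rw [List.finRange_succ, List.flatMap_cons, at_append, List.flatMap_map, ih fun i => h _,
      Fin.forall_fin_succ]
    simp [h, Nat.add_mul, Nat.add_assoc, Nat.add_comm c]

/-- The number `q` in unary is written at position `p`. -/
def NumAt (L : ℕ → Sym → Prop) (p q : ℕ) : Prop := (∀ i < q, L (p + i) .one) ∧ L (p + q) .sep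

theorem at_encNat {p q : ℕ} : At L p (encNat q) ↔ NumAt L p q := by
  have h : At L p (List.replicate q Sym.one) ↔ ∀ i < q, L (p + i) .one := by
    induction q generalizing p with
    | zero => simp
    | succ q ih =>
      rw [List.replicate_succ, at_cons, ih, Nat.forall_lt_succ_left]
      simp [Nat.add_assoc, Nat.add_comm 1]
  simp [encNat, NumAt, h]

@[simp] theorem length_encNat (q : ℕ) : (encNat q).length = q + 1 := by simp [encNat]

theorem at_encRow {n p : ℕ} {P : Fin n → Prop} : At L p (encRow P) ↔
    (∀ i : Fin n, (P i → L (p + i) .one) ∧ (¬P i → L (p + i) .zero)) ∧ L (p + n) .sep := by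
  simp only [encRow, at_append, at_map_finRange, List.length_map, List.length_finRange, at_cons,
    at_nil, and_true]
  refine and_congr_left' (forall_congr' fun i => ?_)
  split_ifs with h <;> simp [h]

@[simp] theorem length_encRow {n : ℕ} (P : Fin n → Prop) : (encRow P).length = n + 1 := by
  simp [encRow]

/-! ### Dependence atoms -/

/-- A list of unary numbers less than `m` is written from position `p` up to position `t`. -/
def ListAt (L : ℕ → Sym → Prop) (m p t : ℕ) : Prop :=
  ∀ l < t, p ≤ l → ∃ a < m, NumAt L l a ∧ l + a < t

/-- The number `a` is an item of the list between the positions `p` and `t`. -/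
def MemAt (L : ℕ → Sym → Prop) (p t a : ℕ) : Prop :=
  ∃ l < t, p ≤ l ∧ ¬L l .one ∧ NumAt L (l + 1) a

open Classical in
/-- The number of separators at positions from `p` on before `t`. -/
noncomputable def sepCount (L : ℕ → Sym → Prop) (p t : ℕ) : ℕ :=
  ((Finset.range t).filter fun i => p ≤ i ∧ L i .sep).card

/-- A dependence atom is written at position `p`, with the symbol `to` at position `t` and the
determined proposition `q`; its arity is at most `k` if `K = some k`. -/
def DepAt (L : ℕ → Sym → Prop) (K : Option ℕ) (m p t q : ℕ) : Prop :=
  p < t ∧ L p .dep ∧ ListAt L m (p + 1) t ∧ L t .to ∧ NumAt L (t + 1) q ∧ q < m ∧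
    ∀ k ∈ K, sepCount L (p + 1) t ≤ k

/-- There is at most one letter at every position. -/
def Functional (L : ℕ → Sym → Prop) : Prop := ∀ i a b, L i a → L i b → a = b

theorem NumAt.unique (hL : Functional L) {p a b : ℕ} (ha : NumAt L p a) (hb : NumAt L p b) :
    a = b := by
  rcases lt_trichotomy a b with h | h | h
  · exact absurd (hL _ _ _ (hb.1 _ h) ha.2) (by simp)
  · exact h
  · exact absurd (hL _ _ _ (ha.1 _ h) hb.2) (by simp)

/-- The word of a list of numbers. -/
def encList {m : ℕ} (ps : List (Fin m)) : List Sym := ps.flatMap fun p : Fin m => encNat p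

@[simp] theorem encList_nil {m : ℕ} : encList ([] : List (Fin m)) = [] := rfl

@[simp] theorem encList_cons {m : ℕ} (a : Fin m) (ps : List (Fin m)) :
    encList (a :: ps) = encNat a ++ encList ps := rfl

theorem encDep_eq {m : ℕ} (ps : List (Fin m)) (q : Fin m) :
    encDep ps q = .dep :: (encList ps ++ .to :: encNat q) := by
  -- In `encDep` the list `ps` is coerced to a list of natural numbers through a monadic bind.
  have h : (ps >>= fun a => pure a.val : List ℕ) = ps.map Fin.val := by
    rw [bind_pure_comp]
    rfl
  rw [encDep, h, List.flatMap_map, encList]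

theorem ListAt.exists_list {m p t : ℕ} (h : ListAt L m p t) (hp : p ≤ t) :
    ∃ ps : List (Fin m), At L p (encList ps) ∧ t = p + (encList ps).length := by
  induction hd : t - p using Nat.strong_induction_on generalizing p with
  | _ d ih =>
    rcases hp.eq_or_lt with rfl | hp
    · exact ⟨[], by simp⟩
    · obtain ⟨a, ha, h1, h2⟩ := h p hp le_rfl
      obtain ⟨ps, h3, h4⟩ := ih (t - (p + a + 1)) (by omega) (p := p + a + 1)
        (fun l hl hl' => h l hl (by omega)) (by omega) rfl
      refine ⟨⟨a, ha⟩ :: ps, ?_, ?_⟩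
      · simpa [at_encNat, h1, Nat.add_assoc] using h3
      · simp
        omega

/-- A suffix of a unary number is again a unary number. Hence `ListAt` can make its demand at every
position of the list, which avoids recursion over the items. -/
theorem listAt_of_at {m p : ℕ} {ps : List (Fin m)} (h : At L p (encList ps)) :
    ListAt L m p (p + (encList ps).length) := by
  induction ps generalizing p with
  | nil => intro l hl hl'; simp at hl; omega
  | cons a ps ih =>
    rw [encList_cons, at_append, at_encNat, length_encNat] at h
    have ih := ih h.2
    intro l hl hl'
    rw [encList_cons, List.length_append, length_encNat] at hl ⊢
    by_cases hla : l ≤ p + a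
    · refine ⟨p + a - l, by omega, ⟨fun i hi => ?_, ?_⟩, by omega⟩
      · have := h.1.1 (l + i - p) (by omega)
        rwa [show p + (l + i - p) = l + i by omega] at this
      · have := h.1.2
        rwa [show l + (p + a - l) = p + a by omega]
    · obtain ⟨b, hb, h1, h2⟩ := ih l (by omega) (by omega)
      exact ⟨b, hb, h1, by omega⟩

/-- The letter before an item is the one at `p` or the separator of the previous item. Requiring it
to differ from `one` excludes proper suffixes of items, and the symbol `to` prevents a number from
starting after the last item. -/
theorem memAt_iff (hL : Functional L) {m p : ℕ} {ps : List (Fin m)} (h : At L (p + 1) (encList ps))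
    (hp : ¬L p .one) (ht : L (p + 1 + (encList ps).length) .to) (a : Fin m) :
    MemAt L p (p + 1 + (encList ps).length) a ↔ a ∈ ps := by
  induction ps generalizing p with
  | nil =>
    simp only [encList_nil, List.length_nil, Nat.add_zero] at ht
    simp only [MemAt, encList_nil, List.length_nil, Nat.add_zero, List.not_mem_nil,
      iff_false, not_exists, not_and]
    rintro l hl hl' - ⟨h1, h2⟩
    obtain rfl : l = p := by omega
    rcases Nat.eq_zero_or_pos (a : ℕ) with h0 | h0
    · exact absurd (hL _ _ _ ht (by simpa [h0] using h2)) (by simp)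
    · exact absurd (hL _ _ _ ht (h1 0 h0)) (by simp)
  | cons b ps ih =>
    rw [encList_cons, at_append, at_encNat, length_encNat] at h
    have hlen : p + 1 + (encList (b :: ps)).length = p + b + 1 + 1 + (encList ps).length := by
      simp
      omega
    rw [hlen] at ht ⊢
    have hs : L (p + b + 1) .sep := by simpa [Nat.add_right_comm] using h.1.2
    have ih := ih (p := p + b + 1) (by
      simpa only [Nat.add_assoc, Nat.add_left_comm, Nat.add_comm] using h.2)
      (fun h' => absurd (hL _ _ _ hs h') (by simp)) ht
    rw [List.mem_cons, ← ih]
    constructor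
    · rintro ⟨l, hl, hl', h1, h2⟩
      rcases hl'.eq_or_lt with rfl | hl'
      · exact .inl (Fin.ext (h2.unique hL h.1))
      · refine .inr ⟨l, hl, ?_, h1, h2⟩
        by_contra hlt
        refine h1 ?_
        have := h.1.1 (l - (p + 1)) (by omega)
        rwa [show p + 1 + (l - (p + 1)) = l by omega] at this
    · rintro (rfl | ⟨l, hl, hl', h1, h2⟩)
      · exact ⟨p, by omega, le_rfl, hp, h.1⟩
      · exact ⟨l, hl, by omega, h1, h2⟩

/-- Every item contains exactly one separator, so counting them measures the arity. -/
theorem sepCount_eq (hL : Functional L) {m p : ℕ} {ps : List (Fin m)} (h : At L p (encList ps)) :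
    sepCount L p (p + (encList ps).length) = ps.length := by
  classical
  induction ps generalizing p with
  | nil =>
    simp only [sepCount, encList_nil, List.length_nil, Nat.add_zero,
      Finset.card_eq_zero, Finset.filter_eq_empty_iff, Finset.mem_range]
    omega
  | cons a ps ih =>
    rw [encList_cons, at_append, at_encNat, length_encNat] at h
    rw [List.length_cons, ← ih h.2, sepCount, sepCount, ← Finset.card_insert_of_notMem (a := p + a)]
    · congr 1
      ext i
      simp only [Finset.mem_filter, Finset.mem_range, Finset.mem_insert, encList_cons, List.length_append, length_encNat]
      constructor
      · rintro ⟨h1, h2, h3⟩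
        by_cases hi : i ≤ p + a
        · left
          by_contra hne
          have := h.1.1 (i - p) (by omega)
          rw [show p + (i - p) = i by omega] at this
          exact absurd (hL _ _ _ this h3) (by simp)
        · exact .inr ⟨by omega, by omega, h3⟩
      · rintro (rfl | ⟨h1, h2, h3⟩)
        · exact ⟨by omega, by omega, h.1.2⟩
        · exact ⟨by omega, by omega, h3⟩
    · simp

theorem depAt_iff (hL : Functional L) {K : Option ℕ} {m p t q : ℕ} : DepAt L K m p t q ↔
    ∃ (ps : List (Fin m)) (q' : Fin m), q = q' ∧ t = p + 1 + (encList ps).length ∧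
      At L p (encDep ps q') ∧ ∀ k ∈ K, ps.length ≤ k := by
  constructor
  · rintro ⟨h1, h2, h3, h4, h5, h6, h7⟩
    obtain ⟨ps, h8, rfl⟩ := h3.exists_list h1
    refine ⟨ps, ⟨q, h6⟩, rfl, rfl, ?_, fun k hk => (sepCount_eq hL h8).symm.trans_le (h7 k hk)⟩
    simp only [encDep_eq, at_cons, at_append, at_encNat]
    exact ⟨h2, h8, h4, h5⟩
  · rintro ⟨ps, q, rfl, rfl, h, hk⟩
    simp only [encDep_eq, at_cons, at_append, at_encNat] at h
    obtain ⟨h2, h8, h4, h5⟩ := h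
    exact ⟨by omega, h2, listAt_of_at h8, h4, h5, q.2, fun k hk' =>
      (sepCount_eq hL h8).trans_le (hk k hk')⟩

theorem memAt_of_encDep (hL : Functional L) {m p : ℕ} {ps : List (Fin m)} {q : Fin m}
    (h : At L p (encDep ps q)) (a : Fin m) : MemAt L p (p + 1 + (encList ps).length) a ↔ a ∈ ps := by
  simp only [encDep_eq, at_cons, at_append, at_encNat] at h
  exact memAt_iff hL h.2.1 (fun h' => absurd (hL _ _ _ h.1 h') (by simp)) h.2.2.1 a

theorem length_encDep {m : ℕ} (ps : List (Fin m)) (q : Fin m) :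
    (encDep ps q).length = 1 + (encList ps).length + q + 2 := by
  simp [encDep_eq]
  omega

/-! ### Certificates -/

/-- The formulas with operators in `M` and with dependence atoms of arity at most `k` if
`K = some k`. -/
def fragment (M : Set Op) (K : Option ℕ) (m : ℕ) : Set (Formula (Fin m)) :=
  {φ | φ.ops ⊆ M ∧ ∀ k ∈ K, φ.ArityLE k}

/-- The local condition for a formula written from position `p` up to position `e`: here `T p s`
means that the world `s` belongs to the team assigned to the position `p`, and `C p e` that a
certified formula is written from position `p` up to position `e`. -/
def Loc (M : Set Op) (K : Option ℕ) (L : ℕ → Sym → Prop) (n m : ℕ) (rel lab T C : ℕ → ℕ → Prop)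
    (p e : ℕ) : Prop :=
  (L p .top ∧ Op.top ∈ M ∧ e = p + 1) ∨
  (L p .bot ∧ Op.bot ∈ M ∧ e = p + 1 ∧ ∀ s < n, ¬T p s) ∨
  (L p .prop ∧ ∃ q < m, NumAt L (p + 1) q ∧ e = p + q + 2 ∧ ∀ s < n, T p s → lab s q) ∨
  (L p .neg ∧ Op.neg ∈ M ∧ L (p + 1) .prop ∧
    ∃ q < m, NumAt L (p + 2) q ∧ e = p + q + 3 ∧ ∀ s < n, T p s → ¬lab s q) ∨
  (Op.dep ∈ M ∧ ∃ t < e, ∃ q < m, DepAt L K m p t q ∧ e = t + q + 2 ∧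
    ∀ s₁ < n, T p s₁ → ∀ s₂ < n, T p s₂ →
      (∃ a < m, MemAt L p t a ∧ ¬(lab s₁ a ↔ lab s₂ a)) ∨ (lab s₁ q ↔ lab s₂ q)) ∨
  (L p .neg ∧ Op.neg ∈ M ∧ Op.dep ∈ M ∧
    (∃ t < e, ∃ q < m, DepAt L K m (p + 1) t q ∧ e = t + q + 2) ∧ ∀ s < n, ¬T p s) ∨
  (p + 1 < e ∧ C (p + 1) e ∧
    ((L p .box ∧ Op.box ∈ M ∧ ∀ s' < n, T (p + 1) s' ↔ ∃ s < n, T p s ∧ rel s s') ∨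
     (L p .dia ∧ Op.dia ∈ M ∧ ∀ s < n, T p s → ∃ s' < n, T (p + 1) s' ∧ rel s s'))) ∨
  -- Here `r` is the position where the second subformula starts.
  ∃ r < e, p + 1 < r ∧ C (p + 1) r ∧ C r e ∧
    ((L p .or ∧ Op.or ∈ M ∧ ∀ s < n, T p s ↔ T (p + 1) s ∨ T r s) ∨
     -- Both disjuncts must be certified as formulas, but only one of them in the team of `p`.
     (L p .cor ∧ Op.cor ∈ M ∧
      ((∀ s < n, T p s ↔ T (p + 1) s) ∨ ∀ s < n, T p s ↔ T r s)) ∨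
     (L p .and ∧ Op.and ∈ M ∧ ∀ s < n, (T p s ↔ T (p + 1) s) ∧ (T p s ↔ T r s)))

/-- This supplies a team in which the unsatisfied side of a classical disjunction can still be
certified. -/
theorem Sat.empty {AP S : Type*} (W : Kripke AP S) (φ : Formula AP) : Sat W ∅ φ := by
  induction φ with
  | top => trivial
  | bot => exact rfl
  | prop q => simp [Sat]
  | negProp q => simp [Sat]
  | or φ ψ hφ hψ => exact ⟨∅, ∅, by simp, hφ, hψ⟩
  | cor φ ψ hφ hψ => exact .inl hφ
  | and φ ψ hφ hψ => exact ⟨hφ, hψ⟩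
  | box φ hφ => simpa [Sat] using hφ
  | dia φ hφ => exact ⟨∅, hφ, by simp⟩
  | dep ps q => simp [Sat]
  | negDep ps q => exact rfl

theorem length_encFormula_pos {m : ℕ} (φ : Formula (Fin m)) : 0 < (encFormula φ).length := by
  cases φ <;> simp [encFormula, encDep]

/-! ### Soundness and completeness of certificates -/

section

variable {M : Set Op} {K : Option ℕ} {L : ℕ → Sym → Prop} {n m : ℕ} {rel lab : ℕ → ℕ → Prop}
  {W : Kripke (Fin m) (Fin n)}

theorem label_inter_singleton_eq_iff {s₁ s₂ : Fin n} {q : Fin m}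
    (hlab : ∀ s p, p ∈ W.label s ↔ lab s p) :
    W.label s₁ ∩ {q} = W.label s₂ ∩ {q} ↔ (lab s₁ q ↔ lab s₂ q) := by
  simp [Set.ext_iff, hlab]

theorem label_inter_ne_iff {s₁ s₂ : Fin n} {ps : List (Fin m)}
    (hlab : ∀ s p, p ∈ W.label s ↔ lab s p) :
    W.label s₁ ∩ {p | p ∈ ps} ≠ W.label s₂ ∩ {p | p ∈ ps} ↔
      ∃ a ∈ ps, ¬(lab s₁ a ↔ lab s₂ a) := by
  simp only [ne_eq, Set.ext_iff, Set.mem_inter_iff, hlab, Set.mem_ofPred_eq, not_forall]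
  exact exists_congr fun a => by tauto

theorem sat_dep_iff (hL : Functional L) (hlab : ∀ s p, p ∈ W.label s ↔ lab s p) {p : ℕ}
    {ps : List (Fin m)} {q : Fin m} (h : At L p (encDep ps q)) {T : ℕ → Prop} {U : Set (Fin n)}
    (hU : ∀ s : Fin n, T s ↔ s ∈ U) : Sat W U (.dep ps q) ↔
      ∀ s₁ < n, T s₁ → ∀ s₂ < n, T s₂ → (∃ a < m, MemAt L p (p + 1 + (encList ps).length) a ∧
        ¬(lab s₁ a ↔ lab s₂ a)) ∨ (lab s₁ q ↔ lab s₂ q) := by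
  have hmem (s₁ s₂ : ℕ) : (∃ a < m, MemAt L p (p + 1 + (encList ps).length) a ∧
      ¬(lab s₁ a ↔ lab s₂ a)) ↔ ∃ a ∈ ps, ¬(lab s₁ a ↔ lab s₂ a) :=
    ⟨fun ⟨a, ha, h1, h2⟩ => ⟨⟨a, ha⟩, (memAt_of_encDep hL h ⟨a, ha⟩).1 h1, h2⟩,
      fun ⟨a, h1, h2⟩ => ⟨a, a.2, (memAt_of_encDep hL h a).2 h1, h2⟩⟩
  simp only [Sat, label_inter_ne_iff hlab, label_inter_singleton_eq_iff hlab, hmem]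
  exact ⟨fun h s₁ h₁ t₁ s₂ h₂ t₂ => h ⟨s₁, h₁⟩ ((hU ⟨s₁, h₁⟩).1 t₁) ⟨s₂, h₂⟩ ((hU ⟨s₂, h₂⟩).1 t₂),
    fun h s₁ h₁ s₂ h₂ => h s₁ s₁.2 ((hU _).2 h₁) s₂ s₂.2 ((hU _).2 h₂)⟩

/-- Certified formulas belong to the fragment and hold in the assigned teams. -/
theorem exists_formula_of_certificate (hL : Functional L) (hrel : ∀ s s', W.R s s' ↔ rel s s')
    (hlab : ∀ s p, p ∈ W.label s ↔ lab s p) {T C : ℕ → ℕ → Prop} {N : ℕ}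
    (h : ∀ p < N, ∀ e < N + 1, C p e → p < e ∧ Loc M K L n m rel lab T C p e) {p e : ℕ}
    (he : e ≤ N) (hp : p < N) (hC : C p e) : ∃ φ ∈ fragment M K m, At L p (encFormula φ) ∧
      e = p + (encFormula φ).length ∧ Sat W {s : Fin n | T p s} φ := by
  -- The conditions on subformulas refer to strictly shorter intervals.
  induction hd : e - p using Nat.strong_induction_on generalizing p e with
  | _ d ih =>
    obtain ⟨hpe, h⟩ := h p hp e (by omega) hC
    rcases h with ⟨h1, h2, rfl⟩ | ⟨h1, h2, rfl, h3⟩ | ⟨h1, q, hq, h2, rfl, h3⟩ |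
      ⟨h1, h0, h2, q, hq, h3, rfl, h4⟩ | ⟨h0, t, ht, q, hq, h1, rfl, h2⟩ |
      ⟨h1, h2, h3, ⟨t, ht, q, hq, h4, rfl⟩, h5⟩ | ⟨h1, h2, h3⟩ | ⟨r, h1, h2, h3, h4, h5⟩
    · refine ⟨.top, ?_, ?_, ?_, ?_⟩
      · simp [fragment, Formula.ops, Formula.ArityLE, h2]
      · simpa [encFormula] using h1
      · simp [encFormula]
      · trivial
    · refine ⟨.bot, ?_, ?_, ?_, ?_⟩
      · simp [fragment, Formula.ops, Formula.ArityLE, h2]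
      · simpa [encFormula] using h1
      · simp [encFormula]
      · exact Set.eq_empty_of_forall_notMem fun s => h3 s s.2
    · refine ⟨.prop ⟨q, hq⟩, ?_, ?_, ?_, ?_⟩
      · simp [fragment, Formula.ops, Formula.ArityLE]
      · simp [encFormula, at_encNat, h1, h2]
      · simp [encFormula, Nat.add_assoc]
      · exact fun s hs => (hlab _ _).2 (h3 s s.2 hs)
    · refine ⟨.negProp ⟨q, hq⟩, ?_, ?_, ?_, ?_⟩
      · simp [fragment, Formula.ops, Formula.ArityLE, h0]
      · simp [encFormula, at_encNat, h1, h2, h3]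
      · simp [encFormula, Nat.add_assoc]
      · exact fun s hs => (hlab _ _).not.2 (h4 s s.2 hs)
    · obtain ⟨ps, q, rfl, rfl, h3, h4⟩ := (depAt_iff hL).1 h1
      refine ⟨.dep ps q, ?_, h3, ?_, (sat_dep_iff hL hlab h3 fun s => Iff.rfl).2 h2⟩
      · simpa [fragment, Formula.ops, Formula.ArityLE, h0] using h4
      · rw [encFormula, length_encDep]
        omega
    · obtain ⟨ps, q, rfl, rfl, h6, h7⟩ := (depAt_iff hL).1 h4
      refine ⟨.negDep ps q, ?_, ?_, ?_, Set.eq_empty_of_forall_notMem fun s => h5 s s.2⟩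
      · simpa [fragment, Formula.ops, Formula.ArityLE, h2, h3, Set.insert_subset_iff] using h7
      · simp [encFormula, h1, h6]
      · rw [encFormula, List.length_cons, length_encDep]
        omega
    · obtain ⟨φ, ⟨hφ, hφ'⟩, h4, h5, h6⟩ := ih (e - (p + 1)) (by omega) he (by omega) h2 rfl
      rcases h3 with ⟨h7, h8, h9⟩ | ⟨h7, h8, h9⟩
      · refine ⟨.box φ, ⟨?_, hφ'⟩, ?_, ?_, ?_⟩
        · simp [Formula.ops, h8, hφ, Set.insert_subset_iff]
        · simp [encFormula, h7, h4]
        · simp only [encFormula, List.length_cons]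
          omega
        · have : {s' : Fin n | ∃ s ∈ {s : Fin n | T p s}, W.R s s'} = {s : Fin n | T (p + 1) s} := by
            ext s'
            simp only [Set.mem_ofPred_eq, h9 s' s'.2, hrel]
            exact ⟨fun ⟨s, h⟩ => ⟨s, s.2, h⟩, fun ⟨s, h, h'⟩ => ⟨⟨s, h⟩, h'⟩⟩
          simpa only [Sat, this] using h6
      · refine ⟨.dia φ, ⟨?_, hφ'⟩, ?_, ?_, _, h6, fun s hs => ?_⟩
        · simp [Formula.ops, h8, hφ, Set.insert_subset_iff]
        · simp [encFormula, h7, h4]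
        · simp only [encFormula, List.length_cons]
          omega
        · obtain ⟨s', h, h', h''⟩ := h9 s s.2 hs
          exact ⟨⟨s', h⟩, h', (hrel _ _).2 h''⟩
    · obtain ⟨φ, ⟨hφ, hφ'⟩, h6, h7, h8⟩ := ih (r - (p + 1)) (by omega) (by omega) (by omega) h3 rfl
      obtain ⟨ψ, ⟨hψ, hψ'⟩, h9, h10, h11⟩ := ih (e - r) (by omega) he (by omega) h4 rfl
      rw [h7] at h9
      rcases h5 with ⟨h12, h13, h14⟩ | ⟨h12, h13, h14⟩ | ⟨h12, h13, h14⟩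
      · refine ⟨.or φ ψ, ⟨?_, fun k hk => ⟨hφ' k hk, hψ' k hk⟩⟩, ?_, ?_, _, _, ?_, h8, h11⟩
        · simp [Formula.ops, h13, hφ, hψ, Set.insert_subset_iff]
        · simp [encFormula, h12, h6, h9]
        · simp only [encFormula, List.length_cons, List.length_append]
          omega
        · ext s
          exact h14 s s.2
      · refine ⟨.cor φ ψ, ⟨?_, fun k hk => ⟨hφ' k hk, hψ' k hk⟩⟩, ?_, ?_, ?_⟩
        · simp [Formula.ops, h13, hφ, hψ, Set.insert_subset_iff]
        · simp [encFormula, h12, h6, h9]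
        · simp only [encFormula, List.length_cons, List.length_append]
          omega
        · refine h14.imp (fun h => ?_) fun h => ?_
          · rwa [show {s : Fin n | T p s} = {s : Fin n | T (p + 1) s} from
              Set.ext fun s => h s s.2]
          · rwa [show {s : Fin n | T p s} = {s : Fin n | T r s} from Set.ext fun s => h s s.2]
      · refine ⟨.and φ ψ, ⟨?_, fun k hk => ⟨hφ' k hk, hψ' k hk⟩⟩, ?_, ?_, ?_, ?_⟩
        · simp [Formula.ops, h13, hφ, hψ, Set.insert_subset_iff]
        · simp [encFormula, h12, h6, h9]
        · simp only [encFormula, List.length_cons, List.length_append]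
          omega
        · rwa [show {s : Fin n | T p s} = {s : Fin n | T (p + 1) s} from
            Set.ext fun s => (h14 s s.2).1]
        · rwa [show {s : Fin n | T p s} = {s : Fin n | T r s} from
            Set.ext fun s => (h14 s s.2).2]

/-- The local condition depends only on the teams at positions of the formula. -/
theorem Loc.congr {T C T' C' : ℕ → ℕ → Prop} {p e : ℕ} (h : Loc M K L n m rel lab T C p e)
    (hpe : p < e) (hT : ∀ i, p ≤ i → i < e → ∀ s < n, T' i s ↔ T i s)
    (hC : ∀ i j, p < i → i < e → j ≤ e → C i j → C' i j) : Loc M K L n m rel lab T' C' p e := by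
  have h0 := hT p le_rfl hpe
  rcases h with h | ⟨h1, h2, h3, h4⟩ | ⟨h1, q, hq, h2, h3, h4⟩ | ⟨h1, h2, h3, q, hq, h4, h5, h6⟩ |
    ⟨h1, t, ht, q, hq, h2, h3, h4⟩ | ⟨h1, h2, h3, h4, h5⟩ | ⟨h1, h2, h3⟩ | ⟨r, h1, h2, h3, h4, h5⟩
  · exact .inl h
  · exact .inr <| .inl ⟨h1, h2, h3, fun s hs => (h0 s hs).not.2 (h4 s hs)⟩
  · exact .inr <| .inr <| .inl ⟨h1, q, hq, h2, h3, fun s hs h => h4 s hs ((h0 s hs).1 h)⟩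
  · exact .inr <| .inr <| .inr <| .inl ⟨h1, h2, h3, q, hq, h4, h5,
      fun s hs h => h6 s hs ((h0 s hs).1 h)⟩
  · exact .inr <| .inr <| .inr <| .inr <| .inl ⟨h1, t, ht, q, hq, h2, h3,
      fun s hs h s' hs' h' => h4 s hs ((h0 s hs).1 h) s' hs' ((h0 s' hs').1 h')⟩
  · exact .inr <| .inr <| .inr <| .inr <| .inr <| .inl ⟨h1, h2, h3, h4,
      fun s hs => (h0 s hs).not.2 (h5 s hs)⟩
  · have h1' := hT (p + 1) (by omega) h1
    refine .inr <| .inr <| .inr <| .inr <| .inr <| .inr <| .inl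
      ⟨h1, hC _ _ (by omega) (by omega) le_rfl h2, h3.imp (fun ⟨h4, h5, h6⟩ => ⟨h4, h5, fun s hs => ?_⟩)
        fun ⟨h4, h5, h6⟩ => ⟨h4, h5, fun s hs h => ?_⟩⟩
    · rw [h1' s hs, h6 s hs]
      exact exists_congr fun s' => and_congr_right fun hs' => and_congr_left' (h0 s' hs').symm
    · obtain ⟨s', hs', h7⟩ := h6 s hs ((h0 s hs).1 h)
      exact ⟨s', hs', (h1' s' hs').2 h7.1, h7.2⟩
  · have h1' := hT (p + 1) (by omega) (by omega)
    have hr := hT r (by omega) h1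
    refine .inr <| .inr <| .inr <| .inr <| .inr <| .inr <| .inr
      ⟨r, h1, h2, hC _ _ (by omega) (by omega) h1.le h3, hC _ _ (by omega) (by omega) le_rfl h4, h5.imp ?_ (.imp ?_ ?_)⟩
    · refine fun ⟨h6, h7, h8⟩ => ⟨h6, h7, fun s hs => ?_⟩
      rw [h0 s hs, h1' s hs, hr s hs, h8 s hs]
    · refine fun ⟨h6, h7, h8⟩ => ⟨h6, h7, h8.imp (fun h s hs => ?_) fun h s hs => ?_⟩
      · rw [h0 s hs, h1' s hs, h s hs]
      · rw [h0 s hs, hr s hs, h s hs]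
    · refine fun ⟨h6, h7, h8⟩ => ⟨h6, h7, fun s hs => ?_⟩
      rw [h0 s hs, h1' s hs, hr s hs]
      exact h8 s hs

/-- The tables `T` and `C` certify a formula written from position `p` up to position `e` and the
team `U`. -/
structure IsCertificate (M : Set Op) (K : Option ℕ) (L : ℕ → Sym → Prop) (m : ℕ)
    (rel lab T C : ℕ → ℕ → Prop) (p e : ℕ) (U : Set (Fin n)) : Prop where
  le : ∀ i j, C i j → p ≤ i
  le' : ∀ i j, C i j → j ≤ e
  lt : ∀ i j, C i j → i < j
  loc : ∀ i j, C i j → Loc M K L n m rel lab T C i j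
  root : C p e
  team : ∀ s : Fin n, T p s ↔ s ∈ U

theorem IsCertificate.leaf {T C : ℕ → ℕ → Prop} {p e : ℕ} {U : Set (Fin n)} (hp : p < e)
    (hC : ∀ i j, C i j ↔ i = p ∧ j = e) (hT : ∀ s : Fin n, T p s ↔ s ∈ U)
    (h : Loc M K L n m rel lab T C p e) : IsCertificate M K L m rel lab T C p e U where
  le i j h := ((hC i j).1 h).1.ge
  le' i j h := ((hC i j).1 h).2.le
  lt i j h := by obtain ⟨rfl, rfl⟩ := (hC i j).1 h; exact hp
  loc i j h' := by obtain ⟨rfl, rfl⟩ := (hC i j).1 h'; exact h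
  root := (hC p e).2 ⟨rfl, rfl⟩
  team := hT

theorem IsCertificate.unary {T C T' C' : ℕ → ℕ → Prop} {p e : ℕ} {U V : Set (Fin n)}
    (h : IsCertificate M K L m rel lab T C (p + 1) e V)
    (hC : ∀ i j, C' i j ↔ (i = p ∧ j = e) ∨ C i j) (hT : ∀ i, p < i → T' i = T i)
    (hTp : ∀ s : Fin n, T' p s ↔ s ∈ U)
    (hloc : Loc M K L n m rel lab T' C' p e) : IsCertificate M K L m rel lab T' C' p e U where
  le i j hij := by
    rcases (hC i j).1 hij with ⟨rfl, rfl⟩ | hij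
    · exact le_rfl
    · exact (Nat.lt_of_succ_le (h.le i j hij)).le
  le' i j hij := by
    rcases (hC i j).1 hij with ⟨rfl, rfl⟩ | hij
    · exact le_rfl
    · exact h.le' i j hij
  lt i j hij := by
    rcases (hC i j).1 hij with ⟨rfl, rfl⟩ | hij
    · have := h.lt _ _ h.root
      omega
    · exact h.lt i j hij
  loc i j hij := by
    rcases (hC i j).1 hij with ⟨rfl, rfl⟩ | hij
    · exact hloc
    · have := h.le i j hij
      exact (h.loc i j hij).congr (h.lt i j hij) (fun x hx _ s _ => by rw [hT x (by omega)])
        fun x y _ _ _ hxy => (hC x y).2 (.inr hxy)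
  root := (hC p e).2 (.inl ⟨rfl, rfl⟩)
  team := hTp

/-- The intervals of the two certificates lie in `[p + 1, r)` and `[r, e)`. By `Loc.congr` each old
local condition sees only its own part of the glued tables. -/
theorem IsCertificate.binary {T₁ C₁ T₂ C₂ T' C' : ℕ → ℕ → Prop} {p r e : ℕ} {U U₁ U₂ : Set (Fin n)}
    (h₁ : IsCertificate M K L m rel lab T₁ C₁ (p + 1) r U₁)
    (h₂ : IsCertificate M K L m rel lab T₂ C₂ r e U₂)
    (hC : ∀ i j, C' i j ↔ (i = p ∧ j = e) ∨ C₁ i j ∨ C₂ i j)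
    (hT₁ : ∀ i, p < i → i < r → T' i = T₁ i) (hT₂ : ∀ i, r ≤ i → T' i = T₂ i)
    (hTp : ∀ s : Fin n, T' p s ↔ s ∈ U)
    (hloc : Loc M K L n m rel lab T' C' p e) : IsCertificate M K L m rel lab T' C' p e U := by
  have hr := h₁.lt _ _ h₁.root
  have he := h₂.lt _ _ h₂.root
  constructor
  · intro i j hij
    rcases (hC i j).1 hij with ⟨rfl, rfl⟩ | hij | hij
    · exact le_rfl
    · have := h₁.le i j hij
      omega
    · have := h₂.le i j hij
      omega
  · intro i j hij
    rcases (hC i j).1 hij with ⟨rfl, rfl⟩ | hij | hij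
    · exact le_rfl
    · have := h₁.le' i j hij
      omega
    · exact h₂.le' i j hij
  · intro i j hij
    rcases (hC i j).1 hij with ⟨rfl, rfl⟩ | hij | hij
    · omega
    · exact h₁.lt i j hij
    · exact h₂.lt i j hij
  · intro i j hij
    rcases (hC i j).1 hij with ⟨rfl, rfl⟩ | hij | hij
    · exact hloc
    · have h3 := h₁.le i j hij
      have h4 := h₁.le' i j hij
      exact (h₁.loc i j hij).congr (h₁.lt i j hij) (fun x hx hx' s _ => by
        rw [hT₁ x (by omega) (by omega)])
        fun x y _ _ _ hxy => (hC x y).2 (.inr (.inl hxy))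
    · have h3 := h₂.le i j hij
      exact (h₂.loc i j hij).congr (h₂.lt i j hij) (fun x hx _ s _ => by
        rw [hT₂ x (by omega)])
        fun x y _ _ _ hxy => (hC x y).2 (.inr (.inr hxy))
  · exact (hC p e).2 (.inl ⟨rfl, rfl⟩)
  · exact hTp

/-- A team as a predicate on natural numbers. -/
def teamPred (U : Set (Fin n)) (s : ℕ) : Prop := ∃ h : s < n, ⟨s, h⟩ ∈ U

@[simp] theorem teamPred_val (U : Set (Fin n)) (s : Fin n) : teamPred U s ↔ s ∈ U := by
  simp [teamPred]

theorem teamPred_of_lt (U : Set (Fin n)) {s : ℕ} (h : s < n) : teamPred U s ↔ ⟨s, h⟩ ∈ U := by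
  simp [teamPred, h]

/-- The gluing is the same for all three binary connectives; each is left with the local condition
at the root. -/
theorem IsCertificate.exists_binary {T₁ C₁ T₂ C₂ : ℕ → ℕ → Prop} {p r e : ℕ}
    {U₁ U₂ : Set (Fin n)} (h₁ : IsCertificate M K L m rel lab T₁ C₁ (p + 1) r U₁)
    (h₂ : IsCertificate M K L m rel lab T₂ C₂ r e U₂) (U : Set (Fin n)) :
    ∃ T C, (p + 1 < r ∧ r < e ∧ C (p + 1) r ∧ C r e) ∧
      (∀ s (h : s < n), (T p s ↔ ⟨s, h⟩ ∈ U) ∧ (T (p + 1) s ↔ ⟨s, h⟩ ∈ U₁) ∧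
        (T r s ↔ ⟨s, h⟩ ∈ U₂)) ∧
      (Loc M K L n m rel lab T C p e → IsCertificate M K L m rel lab T C p e U) := by
  have hr := h₁.lt _ _ h₁.root
  have he := h₂.lt _ _ h₂.root
  refine ⟨fun i => if i = p then teamPred U else if i < r then T₁ i else T₂ i, _,
    ⟨hr, he, .inr (.inl h₁.root), .inr (.inr h₂.root)⟩, fun s hs => ⟨?_, ?_, ?_⟩,
    h₁.binary h₂ (fun _ _ => Iff.rfl) (fun i hi hi' => ?_) (fun i hi => ?_) (by simp)⟩
  · simp [teamPred_of_lt U hs]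
  · simpa [hr] using h₁.team ⟨s, hs⟩
  · simpa [show r ≠ p by omega] using h₂.team ⟨s, hs⟩
  · simp [hi.ne', hi']
  · simp [show i ≠ p by omega, hi.not_gt]

/-- `C` collects the intervals of the subformula occurrences and `T` the teams in which the
semantics evaluates them, with witnesses for the existential clauses taken from `Sat`. -/
theorem exists_certificate (hL : Functional L) (hrel : ∀ s s', W.R s s' ↔ rel s s')
    (hlab : ∀ s p, p ∈ W.label s ↔ lab s p) (φ : Formula (Fin m)) {p : ℕ} {U : Set (Fin n)}
    (hφ : φ ∈ fragment M K m) (hp : At L p (encFormula φ)) (hU : Sat W U φ) :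
    ∃ T C, IsCertificate M K L m rel lab T C p (p + (encFormula φ).length) U := by
  induction φ generalizing p U with
  | top =>
    -- The omitted table `C` is determined by unification with `Iff.rfl`: its only entry is the
    -- whole interval.
    refine ⟨fun _ => teamPred U, _, .leaf (by simp [encFormula]) (fun _ _ => Iff.rfl) (by simp) ?_⟩
    exact .inl ⟨hp.1, hφ.1 rfl, rfl⟩
  | bot =>
    refine ⟨fun _ => teamPred U, _, .leaf (by simp [encFormula]) (fun _ _ => Iff.rfl) (by simp) ?_⟩
    obtain rfl : U = ∅ := hU
    exact .inr <| .inl ⟨hp.1, hφ.1 rfl, rfl, by simp [teamPred]⟩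
  | prop q =>
    refine ⟨fun _ => teamPred U, _, .leaf (by simp [encFormula]) (fun _ _ => Iff.rfl) (by simp) ?_⟩
    simp only [encFormula, at_cons, at_encNat] at hp
    refine .inr <| .inr <| .inl ⟨hp.1, q, q.2, hp.2, by simp [encFormula, Nat.add_assoc], ?_⟩
    rintro s hs ⟨_, h⟩
    exact (hlab ⟨s, hs⟩ q).1 (hU _ h)
  | negProp q =>
    refine ⟨fun _ => teamPred U, _, .leaf (by simp [encFormula]) (fun _ _ => Iff.rfl) (by simp) ?_⟩
    simp only [encFormula, at_cons, at_encNat] at hp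
    refine .inr <| .inr <| .inr <| .inl ⟨hp.1, hφ.1 rfl, hp.2.1, q, q.2, hp.2.2,
      by simp [encFormula, Nat.add_assoc], ?_⟩
    rintro s hs ⟨_, h⟩
    exact (hlab ⟨s, hs⟩ q).not.1 (hU _ h)
  | dep ps q =>
    refine ⟨fun _ => teamPred U, _, .leaf (by simp [encFormula, encDep]) (fun _ _ => Iff.rfl)
      (by simp) ?_⟩
    have hlen := length_encDep ps q
    simp only [encFormula] at hp ⊢
    exact .inr <| .inr <| .inr <| .inr <| .inl ⟨hφ.1 rfl, p + 1 + (encList ps).length, by omega,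
      q, q.2, (depAt_iff hL).2 ⟨ps, q, rfl, rfl, hp, hφ.2⟩, by omega,
      (sat_dep_iff hL hlab hp fun s => teamPred_val U s).1 hU⟩
  | negDep ps q =>
    refine ⟨fun _ => teamPred U, _, .leaf (by simp [encFormula, encDep]) (fun _ _ => Iff.rfl)
      (by simp) ?_⟩
    have hlen := length_encDep ps q
    obtain rfl : U = ∅ := hU
    simp only [encFormula, at_cons, List.length_cons] at hp ⊢
    exact .inr <| .inr <| .inr <| .inr <| .inr <| .inl ⟨hp.1, hφ.1 (.inl rfl), hφ.1 (.inr rfl),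
      ⟨p + 1 + 1 + (encList ps).length, by omega, q, q.2,
        (depAt_iff hL).2 ⟨ps, q, rfl, rfl, hp.2, hφ.2⟩, by omega⟩, by simp [teamPred]⟩
  | box φ ih =>
    have hlen := length_encFormula_pos φ
    simp only [encFormula, at_cons, List.length_cons] at hp ⊢
    obtain ⟨T, C, h⟩ := ih ⟨fun o ho => hφ.1 (.inr ho), hφ.2⟩ hp.2 hU
    rw [show p + 1 + (encFormula φ).length = p + ((encFormula φ).length + 1) by omega] at h
    refine ⟨fun i => if i = p then teamPred U else T i, _, h.unary (fun _ _ => Iff.rfl)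
      (fun i hi => if_neg hi.ne') (by simp) ?_⟩
    refine .inr <| .inr <| .inr <| .inr <| .inr <| .inr <| .inl ⟨by omega, .inr h.root, .inl
      ⟨hp.1, hφ.1 (.inl rfl), fun s' hs' => ?_⟩⟩
    have h1 := h.team ⟨s', hs'⟩
    simp only [Set.mem_ofPred_eq, hrel] at h1
    simp only [if_true, Nat.succ_ne_self, if_false, h1, teamPred]
    exact ⟨fun ⟨s, h, h'⟩ => ⟨s, s.2, ⟨s.2, h⟩, h'⟩, fun ⟨s, h, ⟨_, h'⟩, h''⟩ => ⟨⟨s, h⟩, h', h''⟩⟩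
  | dia φ ih =>
    have hlen := length_encFormula_pos φ
    obtain ⟨V, hV, hUV⟩ := hU
    simp only [encFormula, at_cons, List.length_cons] at hp ⊢
    obtain ⟨T, C, h⟩ := ih ⟨fun o ho => hφ.1 (.inr ho), hφ.2⟩ hp.2 hV
    rw [show p + 1 + (encFormula φ).length = p + ((encFormula φ).length + 1) by omega] at h
    refine ⟨fun i => if i = p then teamPred U else T i, _, h.unary (fun _ _ => Iff.rfl)
      (fun i hi => if_neg hi.ne') (by simp) ?_⟩
    refine .inr <| .inr <| .inr <| .inr <| .inr <| .inr <| .inl ⟨by omega, .inr h.root, .inr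
      ⟨hp.1, hφ.1 (.inl rfl), fun s hs hsU => ?_⟩⟩
    simp only [if_true, teamPred_of_lt U hs] at hsU
    obtain ⟨s', h1, h2⟩ := hUV _ hsU
    exact ⟨s', s'.2, by simpa using (h.team s').2 h1, (hrel _ _).1 h2⟩
  | or φ ψ ihφ ihψ =>
    simp only [encFormula, at_cons, at_append, List.length_cons, List.length_append] at hp ⊢
    have ihφ {V} := ihφ (U := V) ⟨fun o ho => hφ.1 (.inr (.inl ho)), fun k hk => (hφ.2 k hk).1⟩ hp.2.1
    have ihψ {V} := ihψ (U := V) ⟨fun o ho => hφ.1 (.inr (.inr ho)), fun k hk => (hφ.2 k hk).2⟩ hp.2.2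
    rw [show p + 1 + (encFormula φ).length + (encFormula ψ).length =
      p + ((encFormula φ).length + (encFormula ψ).length + 1) by omega] at ihψ
    obtain ⟨U₁, U₂, hU, hU₁, hU₂⟩ := hU
    obtain ⟨_, _, h1⟩ := ihφ hU₁
    obtain ⟨_, _, h2⟩ := ihψ hU₂
    obtain ⟨T, C, ⟨h3, h4, h5, h6⟩, h7, h8⟩ := h1.exists_binary h2 U
    refine ⟨T, C, h8 <| .inr <| .inr <| .inr <| .inr <| .inr <| .inr <| .inr
      ⟨_, h4, h3, h5, h6, .inl ⟨hp.1, hφ.1 (.inl rfl), fun s hs => ?_⟩⟩⟩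
    rw [(h7 s hs).1, (h7 s hs).2.1, (h7 s hs).2.2, hU, Set.mem_union]
  | cor φ ψ ihφ ihψ =>
    simp only [encFormula, at_cons, at_append, List.length_cons, List.length_append] at hp ⊢
    have ihφ {V} := ihφ (U := V) ⟨fun o ho => hφ.1 (.inr (.inl ho)), fun k hk => (hφ.2 k hk).1⟩ hp.2.1
    have ihψ {V} := ihψ (U := V) ⟨fun o ho => hφ.1 (.inr (.inr ho)), fun k hk => (hφ.2 k hk).2⟩ hp.2.2
    rw [show p + 1 + (encFormula φ).length + (encFormula ψ).length =
      p + ((encFormula φ).length + (encFormula ψ).length + 1) by omega] at ihψ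
    rcases hU with hU | hU
    · obtain ⟨_, _, h1⟩ := ihφ hU
      -- The disjunct that may fail in `U` is certified in the empty team.
      obtain ⟨_, _, h2⟩ := ihψ (Sat.empty W ψ)
      obtain ⟨T, C, ⟨h3, h4, h5, h6⟩, h7, h8⟩ := h1.exists_binary h2 U
      refine ⟨T, C, h8 <| .inr <| .inr <| .inr <| .inr <| .inr <| .inr <| .inr
        ⟨_, h4, h3, h5, h6, .inr <| .inl
          ⟨hp.1, hφ.1 (.inl rfl), .inl fun s hs => ?_⟩⟩⟩
      rw [(h7 s hs).1, (h7 s hs).2.1]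
    · obtain ⟨_, _, h1⟩ := ihφ (Sat.empty W φ)
      obtain ⟨_, _, h2⟩ := ihψ hU
      obtain ⟨T, C, ⟨h3, h4, h5, h6⟩, h7, h8⟩ := h1.exists_binary h2 U
      refine ⟨T, C, h8 <| .inr <| .inr <| .inr <| .inr <| .inr <| .inr <| .inr
        ⟨_, h4, h3, h5, h6, .inr <| .inl
          ⟨hp.1, hφ.1 (.inl rfl), .inr fun s hs => ?_⟩⟩⟩
      rw [(h7 s hs).1, (h7 s hs).2.2]
  | and φ ψ ihφ ihψ =>
    simp only [encFormula, at_cons, at_append, List.length_cons, List.length_append] at hp ⊢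
    have ihφ {V} := ihφ (U := V) ⟨fun o ho => hφ.1 (.inr (.inl ho)), fun k hk => (hφ.2 k hk).1⟩ hp.2.1
    have ihψ {V} := ihψ (U := V) ⟨fun o ho => hφ.1 (.inr (.inr ho)), fun k hk => (hφ.2 k hk).2⟩ hp.2.2
    rw [show p + 1 + (encFormula φ).length + (encFormula ψ).length =
      p + ((encFormula φ).length + (encFormula ψ).length + 1) by omega] at ihψ
    obtain ⟨_, _, h1⟩ := ihφ hU.1
    obtain ⟨_, _, h2⟩ := ihψ hU.2
    obtain ⟨T, C, ⟨h3, h4, h5, h6⟩, h7, h8⟩ := h1.exists_binary h2 U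
    refine ⟨T, C, h8 <| .inr <| .inr <| .inr <| .inr <| .inr <| .inr <| .inr
      ⟨_, h4, h3, h5, h6, .inr <| .inr
        ⟨hp.1, hφ.1 (.inl rfl), fun s hs => ?_⟩⟩⟩
    rw [(h7 s hs).1, (h7 s hs).2.1, (h7 s hs).2.2]
    exact ⟨Iff.rfl, Iff.rfl⟩

end

/-! ### Instances -/

/-- A row of `c` bits, closed by a separator, is written at position `p`. -/
def RowAt (L : ℕ → Sym → Prop) (c p : ℕ) : Prop :=
  (∀ i < c, L (p + i) .one ∨ L (p + i) .zero) ∧ L (p + c) .sep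

/-- The position of the adjacency matrix. -/
def relPos (n m : ℕ) : ℕ := n + m + 2

/-- The position of the incidence matrix of the labeling function. -/
def labPos (n m : ℕ) : ℕ := relPos n m + n * (n + 1)

/-- The position of the characteristic vector of the team. -/
def teamPos (n m : ℕ) : ℕ := labPos n m + n * (m + 1)

/-- The position of the formula. -/
def formulaPos (n m : ℕ) : ℕ := teamPos n m + (n + 1)

/-- The accessibility relation that is read off from the word. -/
def relAt (L : ℕ → Sym → Prop) (n m s s' : ℕ) : Prop := L (relPos n m + s * (n + 1) + s') .one

/-- The labeling function that is read off from the word. -/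
def labAt (L : ℕ → Sym → Prop) (n m s a : ℕ) : Prop := L (labPos n m + s * (m + 1) + a) .one

/-- The word of length `N` given by `L` consists of a Kripke structure with `n` worlds and `m`
propositions, a team, and a word such that the tables `T` and `C` certify that it is a formula
which holds in the team. -/
def Check (M : Set Op) (K : Option ℕ) (L : ℕ → Sym → Prop) (N n m : ℕ) (T C : ℕ → ℕ → Prop) :
    Prop :=
  0 < n ∧ NumAt L 0 n ∧ NumAt L (n + 1) m ∧
  (∀ s < n, RowAt L n (relPos n m + s * (n + 1))) ∧
  (∀ s < n, RowAt L m (labPos n m + s * (m + 1))) ∧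
  RowAt L n (teamPos n m) ∧ formulaPos n m < N ∧ C (formulaPos n m) N ∧
  (∀ s < n, T (formulaPos n m) s ↔ L (teamPos n m + s) .one) ∧
  -- The bounds make this a bounded quantification; an end position may equal `N`.
  ∀ p < N, ∀ e < N + 1, C p e → p < e ∧ Loc M K L n m (relAt L n m) (labAt L n m) T C p e

section

variable {M : Set Op} {K : Option ℕ} {L : ℕ → Sym → Prop} {n m : ℕ}

theorem at_encRow_iff (hL : Functional L) {c p : ℕ} {P : Fin c → Prop} :
    At L p (encRow P) ↔ RowAt L c p ∧ ∀ i : Fin c, P i ↔ L (p + i) .one := by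
  rw [at_encRow]
  constructor
  · rintro ⟨h, h'⟩
    refine ⟨⟨fun i hi => ?_, h'⟩, fun i => ⟨(h i).1, fun h1 => ?_⟩⟩
    · by_cases hP : P ⟨i, hi⟩
      · exact .inl ((h ⟨i, hi⟩).1 hP)
      · exact .inr ((h ⟨i, hi⟩).2 hP)
    · by_contra hP
      exact absurd (hL _ _ _ h1 ((h i).2 hP)) (by simp)
  · rintro ⟨⟨h, h'⟩, h1⟩
    exact ⟨fun i => ⟨(h1 i).1, fun hP => (h i i.2).resolve_left fun h2 => hP ((h1 i).2 h2)⟩, h'⟩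

theorem at_encInstance (hL : Functional L) {W : Kripke (Fin m) (Fin n)} {U : Set (Fin n)}
    {φ : Formula (Fin m)} : At L 0 (encInstance W U φ) ↔ NumAt L 0 n ∧ NumAt L (n + 1) m ∧
      (∀ s : Fin n, RowAt L n (relPos n m + s * (n + 1)) ∧ ∀ s', W.R s s' ↔ relAt L n m s s') ∧
      (∀ s : Fin n, RowAt L m (labPos n m + s * (m + 1)) ∧
        ∀ a, a ∈ W.label s ↔ labAt L n m s a) ∧
      (RowAt L n (teamPos n m) ∧ ∀ s : Fin n, s ∈ U ↔ L (teamPos n m + s) .one) ∧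
      At L (formulaPos n m) (encFormula φ) := by
  simp only [encInstance, at_append, at_encNat, List.length_append, length_encNat,
    length_encRow, length_flatMap_finRange (fun i => length_encRow _),
    at_flatMap_finRange (fun i => length_encRow _), at_encRow_iff hL, and_assoc, Nat.zero_add]
  have e : n + 1 + (m + 1) = n + m + 2 := by omega
  simp only [e, relAt, labAt, formulaPos, teamPos, labPos, relPos]

theorem length_encInstance (W : Kripke (Fin m) (Fin n)) (U : Set (Fin n)) (φ : Formula (Fin m)) :
    (encInstance W U φ).length = formulaPos n m + (encFormula φ).length := by
  simp only [encInstance, List.length_append, length_encNat,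
    length_encRow, length_flatMap_finRange (fun i => length_encRow _), formulaPos, teamPos, labPos,
    relPos]
  omega

theorem functional_getElem? (x : List Sym) : Functional fun i a => x[i]? = some a :=
  fun _ _ _ h h' => Option.some.inj (h.symm.trans h')

theorem eq_iff_at {x u : List Sym} :
    x = u ↔ At (fun i a => x[i]? = some a) 0 u ∧ x.length = u.length := by
  rw [at_getElem?, List.drop_zero]
  exact ⟨fun h => h ▸ ⟨List.prefix_rfl, rfl⟩, fun h => (h.1.eq_of_length h.2.symm).symm⟩

theorem mem_modelChecking_iff {x : List Sym} : x ∈ modelChecking (fragment M K) ↔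
    ∃ n m T C, Check M K (fun i a => x[i]? = some a) x.length n m T C := by
  have hL := functional_getElem? x
  constructor
  · rintro ⟨n, m, W, U, φ, hφ, hU, hx⟩
    rw [eq_iff_at, at_encInstance hL, length_encInstance] at hx
    obtain ⟨⟨h1, h2, h3, h4, h5, h6⟩, h7⟩ := hx
    obtain ⟨T, C, h⟩ := exists_certificate hL (fun s => (h3 s).2) (fun s => (h4 s).2) φ hφ h6 hU
    have := length_encFormula_pos φ
    refine ⟨n, m, T, C, Fin.pos_iff_nonempty.2 W.nonempty, h1, h2, fun s hs => (h3 ⟨s, hs⟩).1,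
      fun s hs => (h4 ⟨s, hs⟩).1, h5.1, by omega, h7 ▸ h.root, fun s hs => ?_,
      fun p _ e _ hC => ⟨h.lt p e hC, h.loc p e hC⟩⟩
    exact (h.team ⟨s, hs⟩).trans (h5.2 ⟨s, hs⟩)
  · rintro ⟨n, m, T, C, h1, h2, h3, h4, h5, h6, h7, h8, h9, h10⟩
    let W : Kripke (Fin m) (Fin n) := ⟨⟨⟨0, h1⟩⟩, fun s s' =>
      relAt (fun i a => x[i]? = some a) n m s s',
      fun s => {a | labAt (fun i a => x[i]? = some a) n m s a}⟩
    obtain ⟨φ, hφ, h11, h12, h13⟩ := exists_formula_of_certificate (W := W) hL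
      (fun _ _ => Iff.rfl) (fun _ _ => Iff.rfl) h10 le_rfl h7 h8
    refine ⟨n, m, W, _, φ, hφ, h13, ?_⟩
    rw [eq_iff_at, at_encInstance hL, length_encInstance]
    exact ⟨⟨h2, h3, fun s => ⟨h4 s s.2, fun _ => Iff.rfl⟩, fun s => ⟨h5 s s.2, fun _ => Iff.rfl⟩,
      ⟨h6, fun s => h9 s s.2⟩, h11⟩, h12⟩

/-- Only finitely many entries matter, so the tables can be stored as bits. -/
theorem Check.congr {N : ℕ} {T C T' C' : ℕ → ℕ → Prop} (h : Check M K L N n m T C)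
    (hT : ∀ p < N, ∀ s < N, T' p s ↔ T p s) (hC : ∀ p < N, ∀ e < N + 1, C' p e ↔ C p e) :
    Check M K L N n m T' C' := by
  obtain ⟨h1, h2, h3, h4, h5, h6, h7, h8, h9, h10⟩ := h
  have hn : n < N := by
    simp only [formulaPos] at h7
    omega
  refine ⟨h1, h2, h3, h4, h5, h6, h7, (hC _ h7 _ (by omega)).2 h8, fun s hs => ?_,
    fun p hp e he h => ?_⟩
  · rw [hT _ h7 s (by omega), h9 s hs]
  · obtain ⟨h11, h12⟩ := h10 p hp e he ((hC p hp e he).1 h)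
    exact ⟨h11, h12.congr h11 (fun i hi hi' s hs => hT i (by omega) s (by omega))
      fun i j hi hi' hj => (hC i (by omega) j (by omega)).2⟩

end

/-! ### Certificates as bit strings -/

/-- The table of teams in a word that starts with `N` letters of the input. -/
def teamTable (z : List (Sym ⊕ Bool)) (N p s : ℕ) : Prop :=
  -- Position `p` owns a block of `2 * (N + 1)` bits: first `N + 1` for worlds, then `N + 1` for end
  -- positions `e ≤ N`.
  z[N + (p * (2 * (N + 1)) + s)]? = some (.inr true)

/-- The table of certified formulas in a word that starts with `N` letters of the input. -/
def formulaTable (z : List (Sym ⊕ Bool)) (N p e : ℕ) : Prop :=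
  z[N + (p * (2 * (N + 1)) + (N + 1 + e))]? = some (.inr true)

/-- The word consists of an input and of a certificate for it; its length is at most `l`. -/
def Verify (M : Set Op) (K : Option ℕ) (z : List (Sym ⊕ Bool)) (l : ℕ) : Prop :=
  -- The expression is given only the total length `l`, so the input length `N` is recovered as the
  -- place where the input letters stop.
  ∃ N < l + 1, (∀ i < N, z[i]?.any Sum.isLeft) ∧ (¬z[N]?.any Sum.isLeft) ∧
    ∃ n < N, ∃ m < N, Check M K (fun i a => z[i]? = some (.inl a)) N n m (teamTable z N)
      (formulaTable z N)

theorem isPred_arity {Γ : Type} {f : List Γ → (ℕ → ℕ) → ℕ} (hf : IsExpr f) (K : Option ℕ) :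
    IsPred fun z env => ∀ k ∈ K, f z env ≤ k := by
  cases K with
  | none => simpa using IsPred.const True
  | some k => simpa using IsPred.le hf (.const k)

/-- After unfolding, only bounded quantifiers, connectives, comparisons, letter tests, counting and
arithmetic remain, and the closure lemmas apply along the syntax. -/
theorem isPred_verify (M : Set Op) (K : Option ℕ) :
    IsPred fun z env => Verify M K z (env 0) := by
  simp only [Verify, Check, Loc, DepAt, ListAt, MemAt, RowAt, NumAt, sepCount, teamTable,
    formulaTable, relAt, labAt, formulaPos, teamPos, labPos, relPos]
  repeat' first
    | exact IsPred.const _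
    | exact IsExpr.var _
    | exact IsExpr.const _
    | apply IsPred.letter
    | apply IsPred.test
    | apply IsPred.all
    | apply IsPred.ex
    | apply isPred_arity
    | apply IsPred.lt
    | apply IsPred.le
    | apply IsPred.eq
    | apply IsPred.iff
    | apply IsPred.and
    | apply IsPred.or
    | apply IsPred.not
    | apply IsPred.imp
    | apply IsExpr.add
    | apply IsExpr.mul
    | apply IsExpr.card

theorem verify_append_iff {M : Set Op} {K : Option ℕ} {x : List Sym} {w : List Bool} :
    Verify M K (x.map .inl ++ w.map .inr) (x.length + w.length) ↔ ∃ n m,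
      Check M K (fun i a => x[i]? = some a) x.length n m
        (fun p s => w[p * (2 * (x.length + 1)) + s]? = some true)
        (fun p e => w[p * (2 * (x.length + 1)) + (x.length + 1 + e)]? = some true) := by
  have hl (i : ℕ) (a : Sym) : (x.map Sum.inl ++ w.map Sum.inr)[i]? = some (.inl a) ↔
      x[i]? = some a := by
    rcases lt_or_ge i x.length with h | h
    · simp [List.getElem?_append_left, h]
    · simp [List.getElem?_append_right, h]
  have hr (i : ℕ) : (x.map Sum.inl ++ w.map Sum.inr)[x.length + i]? = some (.inr true) ↔
      w[i]? = some true := by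
    simp [List.getElem?_append_right]
  have hi (i : ℕ) : (x.map Sum.inl ++ w.map Sum.inr)[i]?.any Sum.isLeft ↔ i < x.length := by
    rcases lt_or_ge i x.length with h | h
    · simp [List.getElem?_append_left, h]
    · rw [List.getElem?_append_right (by simpa using h), List.getElem?_map]
      cases w[i - (x.map (Sum.inl (β := Bool))).length]? <;> simp [h]
  simp only [Verify, hi, hl]
  constructor
  · rintro ⟨N, -, h1, h2, n, -, m, -, h⟩
    obtain rfl : N = x.length :=
      le_antisymm (not_lt.1 fun h => lt_irrefl _ (h1 _ h)) (not_lt.1 h2)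
    exact ⟨n, m, h.congr (fun p _ s _ => (hr _).symm) fun p _ e _ => (hr _).symm⟩
  · rintro ⟨n, m, h⟩
    -- The formula starts inside the word, behind `n` and `m` in unary, which gives `n, m <
    -- x.length`.
    have h7 := h.2.2.2.2.2.2.1
    simp only [formulaPos, teamPos, labPos, relPos] at h7
    exact ⟨x.length, by omega, fun i hi => hi, lt_irrefl _, n, by omega, m, by omega,
      h.congr (fun p _ s _ => hr _) fun p _ e _ => hr _⟩

theorem getElem?_map_range_mul {f : ℕ → ℕ → Bool} {N D p c : ℕ} (hp : p < N) (hc : c < D) :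
    ((List.range (N * D)).map fun i => f (i / D) (i % D))[p * D + c]? = some (f p c) := by
  have h : p * D + c < N * D := by
    have := Nat.mul_le_mul_right D (Nat.succ_le_of_lt hp)
    rw [Nat.succ_mul] at this
    omega
  have h1 : (p * D + c) / D = p := by
    rw [Nat.add_comm, Nat.add_mul_div_right _ _ (by omega), Nat.div_eq_of_lt hc, Nat.zero_add]
  have h2 : (p * D + c) % D = c := by
    rw [Nat.add_comm, Nat.add_mul_mod_self_right, Nat.mod_eq_of_lt hc]
  simp [h, h1, h2]

theorem inNP_modelChecking_fragment (M : Set Op) (K : Option ℕ) :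
    InNP (modelChecking (fragment M K)) := by
  classical
  obtain ⟨e, he⟩ := isPred_verify M K
  -- The certificate has one block of `2 * (|x| + 1)` bits for each of the `|x|` positions.
  refine inNP_of_expr e (.X * (2 * (.X + 1))) fun x => ?_
  simp only [he, mem_modelChecking_iff, verify_append_iff]
  constructor
  · rintro ⟨n, m, T, C, h⟩
    let f (p c : ℕ) : Bool := if c < x.length + 1 then T p c else C p (c - (x.length + 1))
    refine ⟨(List.range (x.length * (2 * (x.length + 1)))).map fun i =>
      f (i / (2 * (x.length + 1))) (i % (2 * (x.length + 1))), by simp, n, m,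
        h.congr (fun p hp s hs => ?_) fun p hp e he => ?_⟩
    · rw [getElem?_map_range_mul hp (by omega)]
      simp only [f, if_pos (show s < x.length + 1 by omega), Option.some.injEq, decide_eq_true_eq]
    · rw [getElem?_map_range_mul hp (by omega)]
      simp only [f, if_neg (show ¬x.length + 1 + e < x.length + 1 by omega), Option.some.injEq,
        decide_eq_true_eq, Nat.add_sub_cancel_left]
  · rintro ⟨w, -, n, m, h⟩
    exact ⟨n, m, _, _, h⟩

end ModalDep

theorem proposition3p1 :
    ∀ M : Set ModalDep.Op,
      ModalDep.InNP (ModalDep.MDLMC M) ∧ ∀ k : ℕ, ModalDep.InNP (ModalDep.MDLMCk k M) := by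
  intro M
  refine ⟨?_, fun k => ?_⟩
  · have h : (fun m => ModalDep.MDL (Fin m) M) = ModalDep.fragment M none := by
      funext m
      simp [ModalDep.MDL, ModalDep.fragment]
    rw [ModalDep.MDLMC, h]
    exact ModalDep.inNP_modelChecking_fragment M none
  · have h : (fun m => ModalDep.MDLk (Fin m) k M) = ModalDep.fragment M (some k) := by
      funext m
      simp [ModalDep.MDLk, ModalDep.fragment]
    rw [ModalDep.MDLMCk, h]
    exact ModalDep.inNP_modelChecking_fragment M (some k)
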